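/- Setting. Fix a photon cutoff $\Lambda\in\mathbb N$ and work on $\mathbb C^2\otimes\mathbb C^{\Lambda+1}$ (one qubit, one oscillator mode with photon numbers $0,\dots,\Lambda$), with operator norm $\|\cdot\|$. Let $a$ be the truncated annihilation operator, $a|m\rangle=\sqrt m\,|m-1\rangle$, and for an operator $A$ on the mode put $G(A)=|0\rangle\langle 1|\otimes A^\dagger+|1\rangle\langle 0|\otimes A$. For $t\in\mathbb R$ let $$\mathcal S_1(t)=e^{itG(a)},\qquad \mathcal T_k(t)=e^{itG(a^k)},\qquad \mathcal P_k(t)=e^{itG(|0\rangle\langle 0|a^k)},\qquad R_{Z0}=1\otimes(1-2|0\rangle\langle 0|).$$ A circuit is a finite product of gates $\mathcal S_1(s)$ ($s\in\mathbb R$), single-qubit unitaries, and $R_{Z0}$; the gate times and the single-qubit unitaries do not depend on $\Lambda$. The cost of a circuit is its number of $\mathcal S_1$ gates. For a family of circuits $\widetilde{\mathcal T}(t)$, $t\in\mathbb R$, and a real $p>1$ let $$\mathcal F_{k,p}(t)=\mathrm{Trotter}_{2q}\big(\widetilde{\mathcal T}(t/2),\;R_{Z0}\,\widetilde{\mathcal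 T}(-t/2)\,R_{Z0}\big),\qquad q=\max(\lceil (p-1)/2\rceil,1),$$ where, for circuit families $U_1,U_2$, $\mathrm{Trotter}_2(x)=U_1(x/2)U_2(x/2)U_2(x/2)U_1(x/2)$ and $\mathrm{Trotter}_{2q}(x)=\mathrm{Trotter}_{2q-2}(p_qx)^2\,\mathrm{Trotter}_{2q-2}((1-4p_q)x)\,\mathrm{Trotter}_{2q-2}(p_qx)^2$ with $p_q=(4-4^{1/(2q-1)})^{-1}$ for $q\ge2$; here $U_1(x)=\widetilde{\mathcal T}(x/2)$, $U_2(x)=R_{Z0}\widetilde{\mathcal T}(-x/2)R_{Z0}$, evaluated at $x=t$. Theorem. Let $k\ge 1$ be an integer with $n$ binary digits, let $p>1$ be real, and put $$N=n^{1.6}\cdot 30^{np}\cdot 420^{n^2p/2}\cdot 6^{\log_2 n+1}.$$ There are a family of circuits $\widetilde{\mathcal T}_{k,p}(t)$, $t\in\mathbb R$, made only of $\mathcal S_1$ gates and single-qubit gates, each of cost at most $N$, and constants $C,C',c_1,c_2>0$, all depending only on $k$ and $p$, such that for every $\Lambda\ge k$ and $t\in\mathbb R$ $$\|\widetilde{\mathcal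 T}_{k,p}(t)-\mathcal T_k(t)\|\le C\,(\Lambda^{k/2}|t|)^p,\qquad \|\mathcal F_{k,p}(t)-\mathcal P_k(t)\|\le C'\,(\Lambda^{k/2}|t|)^p,$$ where $\mathcal F_{k,p}$ is built from $\widetilde{\mathcal T}_{k,p}$ as above, and such that the following holds. For every $\Lambda\ge k$, every $t=(2j+1)\pi/(2\sqrt{k!})$ with $j\in\mathbb N$, and every $0<\delta\le 1$ there is $r\in\mathbb N$ with $$c_1\,\frac{(\Lambda^{k/2}t)^{1+1/(p-1)}}{(\delta/2)^{1/(p-1)}}\;\le\; r\;\le\; c_2\,\frac{(\Lambda^{k/2}t)^{1+1/(p-1)}}{(\delta/2)^{1/(p-1)}}$$ such that the time-sliced circuit $\mathcal F_{k,p}(t/r)^r$ prepares $|0\rangle\otimes|k\rangle$ from $|1\rangle\otimes|0\rangle$ with probability $$\big|\langle 0,k|\,\mathcal F_{k,p}(t/r)^r\,|1,0\rangle\big|^2\ge 1-\delta,$$ and this circuit uses at most $r\cdot 2\cdot 5^{p/2}\cdot N$ gates $\mathcal S_1$. -/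

import Mathlib

open scoped Kronecker Matrix Matrix.Norms.L2Operator

namespace HybridOscillator

noncomputable section

/-- Basis labels `(q, m)` of one qubit and one oscillator mode truncated at `Λ` photons:
`q` is the qubit state and `m` the photon number, `0 ≤ m ≤ Λ`. -/
abbrev Idx (Λ : ℕ) : Type := Fin 2 × Fin (Λ + 1)

/-- Operators on the qubit-oscillator space `ℂ² ⊗ ℂ^(Λ+1)`.
Norms of operators are the spectral (Euclidean operator) norm. -/
abbrev Op (Λ : ℕ) : Type := Matrix (Idx Λ) (Idx Λ) ℂ

/-- The truncated annihilation operator: `a |m⟩ = √m |m - 1⟩`, `a |0⟩ = 0`. -/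
def annihilation (Λ : ℕ) : Matrix (Fin (Λ + 1)) (Fin (Λ + 1)) ℂ :=
  Matrix.of fun i j => if (j : ℕ) = (i : ℕ) + 1 then ((Real.sqrt (j : ℝ) : ℝ) : ℂ) else 0

/-- The vacuum projector `|0⟩⟨0|` of the oscillator. -/
def vacuum (Λ : ℕ) : Matrix (Fin (Λ + 1)) (Fin (Λ + 1)) ℂ :=
  Matrix.single 0 0 1

/-- The Hermitian block encoding `|0⟩⟨1| ⊗ A† + |1⟩⟨0| ⊗ A`, i.e. the block matrix
with upper right block `A†` and lower left block `A`. -/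
def blockEncode {Λ : ℕ} (A : Matrix (Fin (Λ + 1)) (Fin (Λ + 1)) ℂ) : Op Λ :=
  (Matrix.single (0 : Fin 2) (1 : Fin 2) (1 : ℂ)) ⊗ₖ Aᴴ
    + (Matrix.single (1 : Fin 2) (0 : Fin 2) (1 : ℂ)) ⊗ₖ A

/-- The elementary gate `S₁(t) = exp (i t [0, a†; a, 0])`. -/
def sOne (Λ : ℕ) (t : ℝ) : Op Λ :=
  NormedSpace.exp ((Complex.I * (t : ℂ)) • blockEncode (annihilation Λ))

/-- The ideal block encoding `T_k(t) = exp (i t [0, (a†)^k; a^k, 0])`. -/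
def idealT (Λ k : ℕ) (t : ℝ) : Op Λ :=
  NormedSpace.exp ((Complex.I * (t : ℂ)) • blockEncode (annihilation Λ ^ k))

/-- The ideal Fock preparation operator
`P_k(t) = exp (i t [0, (a†)^k |0⟩⟨0|; |0⟩⟨0| a^k, 0])`. -/
def idealP (Λ k : ℕ) (t : ℝ) : Op Λ :=
  NormedSpace.exp ((Complex.I * (t : ℂ)) • blockEncode (vacuum Λ * annihilation Λ ^ k))

/-- The instruction set: the gate `S₁(t)` for real `t`, a single-qubit unitary, and the phase flip
of the oscillator vacuum. -/
inductive Gate : Type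
  | sOne (t : ℝ) : Gate
  | qubit (U : Matrix.unitaryGroup (Fin 2) ℂ) : Gate
  | vacuumFlip : Gate

/-- The operator performed by a gate; the vacuum flip is `R_{Z0} = 1 ⊗ (1 - 2 |0⟩⟨0|)`. -/
def Gate.op (Λ : ℕ) : Gate → Op Λ
  | .sOne t => HybridOscillator.sOne Λ t
  | .qubit U => (U : Matrix (Fin 2) (Fin 2) ℂ) ⊗ₖ (1 : Matrix (Fin (Λ + 1)) (Fin (Λ + 1)) ℂ)
  | .vacuumFlip => (1 : Matrix (Fin 2) (Fin 2) ℂ) ⊗ₖ (1 - (2 : ℂ) • vacuum Λ)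

/-- The number of `S₁` gates that a gate contributes. -/
def Gate.sOneCost : Gate → ℕ
  | .sOne _ => 1
  | .qubit _ => 0
  | .vacuumFlip => 0

/-- A circuit is written like an operator product: its first gate is the leftmost factor. -/
abbrev Circuit : Type := List Gate

/-- The operator performed by a circuit. -/
def Circuit.op (Λ : ℕ) (c : Circuit) : Op Λ := (c.map (Gate.op Λ)).prod

/-- The number of `S₁` gates in a circuit, counted with multiplicity. -/
def Circuit.sOneCount (c : Circuit) : ℕ := (c.map Gate.sOneCost).sum

/-- The repetition of a circuit `r` times. -/
def Circuit.repeated (c : Circuit) (r : ℕ) : Circuit := (List.replicate r c).flatten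

/-- The Suzuki coefficient `p_q = (4 - 4^(1/(2q-1)))⁻¹`. -/
def suzukiCoeff (q : ℕ) : ℝ := (4 - (4 : ℝ) ^ (1 / (2 * (q : ℝ) - 1)))⁻¹

/-- The Trotter-Suzuki formula `Trotter_{2q}` for two (possibly approximate) exponentials
`U₁(x)` and `U₂(x)`; it is meant for `q ≥ 1` (the value at `q = 0` is a placeholder). -/
def trotter (U₁ U₂ : ℝ → Circuit) : ℕ → ℝ → Circuit
  | 0, _ => []
  | 1, x => U₁ (x / 2) ++ U₂ (x / 2) ++ U₂ (x / 2) ++ U₁ (x / 2)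
  | q + 2, x =>
      let y := suzukiCoeff (q + 2) * x
      let z := (1 - 4 * suzukiCoeff (q + 2)) * x
      trotter U₁ U₂ (q + 1) y ++ trotter U₁ U₂ (q + 1) y ++ trotter U₁ U₂ (q + 1) z
        ++ trotter U₁ U₂ (q + 1) y ++ trotter U₁ U₂ (q + 1) y

/-- The index `q = max (⌈(p - 1)/2⌉, 1)` of the Trotter formula used at order `p`. -/
def trotterIndex (p : ℝ) : ℕ := max ⌈(p - 1) / 2⌉₊ 1

/-- The approximate Fock preparation circuit `F_{k,p}(t)` built from circuits `T` approximating
`T_k`: the formula `Trotter_{2q}` applied to `T(t/2)` and `R_{Z0} T(-t/2) R_{Z0}`. -/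
def fockPrep (T : ℝ → Circuit) (p : ℝ) (t : ℝ) : Circuit :=
  trotter (fun x => T (x / 2))
    (fun x => [Gate.vacuumFlip] ++ T (-(x / 2)) ++ [Gate.vacuumFlip]) (trotterIndex p) t

/-- `T` implements `T_k` to order `p`: each `T(t)` consists of `S₁` gates and single-qubit gates
only, and `‖T(t) - T_k(t)‖ = O((Λ^(k/2) |t|)^p)` with a constant independent of `t` and of the
cutoff `Λ`. -/
def IsOrderImplementation (k : ℕ) (p : ℝ) (T : ℝ → Circuit) : Prop :=
  (∀ t : ℝ, Gate.vacuumFlip ∉ T t) ∧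
  ∃ C : ℝ, 0 < C ∧ ∀ Λ : ℕ, k ≤ Λ → ∀ t : ℝ,
    ‖Circuit.op Λ (T t) - idealT Λ k t‖ ≤ C * ((Λ : ℝ) ^ ((k : ℝ) / 2) * |t|) ^ p

/-- The computational basis state `|q⟩ ⊗ |m⟩`. -/
def ket {Λ : ℕ} (q : Fin 2) (m : Fin (Λ + 1)) : Idx Λ → ℂ := Pi.single (q, m) 1

/-- The probability of finding `|0⟩ ⊗ |k⟩` when the operator `M` acts on `|1⟩ ⊗ |0⟩`. -/
def successProb {Λ k : ℕ} (hk : k ≤ Λ) (M : Op Λ) : ℝ :=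
  ‖star (ket (0 : Fin 2) (⟨k, Nat.lt_succ_of_le hk⟩ : Fin (Λ + 1))) ⬝ᵥ
    (M *ᵥ ket (1 : Fin 2) (0 : Fin (Λ + 1)))‖ ^ 2

/-- The bound `n^1.6 · 30^(np) · 420^(n²p/2) · 6^(log₂ n + 1)`. -/
def blockCost (n : ℕ) (p : ℝ) : ℝ :=
  (n : ℝ) ^ (1.6 : ℝ) * (30 : ℝ) ^ ((n : ℝ) * p) * (420 : ℝ) ^ ((n : ℝ) ^ 2 * p / 2)
    * (6 : ℝ) ^ (Real.logb 2 (n : ℝ) + 1)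

/-- The scale `(Λ^(k/2) t)^(1 + 1/(p-1)) / (δ/2)^(1/(p-1))` of the number of time slices. -/
def sliceScale (Λ k : ℕ) (p t δ : ℝ) : ℝ :=
  ((Λ : ℝ) ^ ((k : ℝ) / 2) * t) ^ (1 + 1 / (p - 1)) / (δ / 2) ^ (1 / (p - 1))

end

end HybridOscillator

open HybridOscillator

open scoped ENNReal
open Filter Topology Asymptotics

/-! Uniformity in Λ comes from working in a single Banach algebra. In `OpFamily`, the uniformly
bounded families of operators indexed by Λ, a and a† are divided by √Λ and so have norm at most 1. A
circuit with all gate times multiplied by y becomes one analytic function of y, and an estimate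
O(y^m) at zero has one constant for all cutoffs. Substituting y = √Λ t^(1/k) turns y^k into Λ^(k/2)
t; away from zero the trivial bound 2 for a difference of contractions is enough
(`OpFamily.exists_rpow_bound`).

The circuit for T_k arises in two stages. A group commutator of 1 + y^i A and 1 + y^j B starts with
y^(i+j) [A, B]. Two such brackets with matched qubit phases add up so that the mixed products of a
and a† cancel (`ladder_bracket`), and halving k gives the leading order with 12^n gates when k ≤ 2^n
(`hasCircuit_ladder`). If then c(y) = exp(y^k L) + Σ y^j e_j + ..., with all j > k, a product of
factors c(γy) c(βy)⁻¹ has exponent Σ(γ^k - β^k) and errors Σ(γ^j - β^j) e_j, up to k orders beyond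
the first error. Finitely many pairs make these sums 1 at k and 0 at the next k error exponents
(`exists_pairs_power_sums`), which gains k orders for a factor 2k + 2 in cost
(`exists_circuit_order_add`). The stated bound N leaves ample room.

For P_k, a^k |0⟩ = 0 implies that conjugation by R_{Z0} flips the sign of exactly the part |0⟩⟨0|
a^k of the generator. Half the difference of the generator and its reflection therefore generates
P_k, and the Trotter-Suzuki formula combines the two (`trotterProd_sub_isBigO`). Finally P_k(t)
takes |1,0⟩ to |0,k⟩ with amplitude i sin(√k! t), of modulus 1 at the given times, and r slices
accumulate an error r C (τ/r)^p with τ = Λ^(k/2) t, which dictates r. -/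

namespace HybridOscillator

/-! ### Prescribed differences of power sums -/

/-- The velocity vectors of the moment curve with positive exponents span the whole space. -/
theorem span_moment_velocity_eq_top (J : Finset ℕ) (hJ : 0 ∉ J) :
    Submodule.span ℝ (Set.range fun b : Set.Ioi (0 : ℝ) => fun j : J =>
      ((j : ℕ) : ℝ) * (b : ℝ) ^ ((j : ℕ) - 1)) = ⊤ := by
  by_contra hne
  obtain ⟨f, hf0, hf⟩ := Submodule.exists_le_ker_of_lt_top _ (lt_top_iff_ne_top.2 hne)
  apply hf0
  -- A functional f that kills all velocities is a polynomial vanishing on the positive reals. Its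
  -- coefficients j f(e_j) determine f because 0 ∉ J.
  let P : Polynomial ℝ := ∑ j : J, Polynomial.monomial ((j : ℕ) - 1) (f (Pi.single j 1) * (j : ℕ))
  have hroot : ∀ b : ℝ, 0 < b → P.eval b = 0 := by
    intro b hb
    have h1 := hf (Submodule.subset_span ⟨⟨b, hb⟩, rfl⟩)
    rw [LinearMap.mem_ker, LinearMap.pi_apply_eq_sum_univ] at h1
    rw [← h1]
    simp only [P, Polynomial.eval_finsetSum, Polynomial.eval_monomial, smul_eq_mul]
    refine Finset.sum_congr rfl fun j _ => ?_
    have : (fun i => if j = i then (1 : ℝ) else 0) = Pi.single j 1 := by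
      ext i; simp [Pi.single_apply, eq_comm]
    rw [this]; ring
  have hP : P = 0 := Polynomial.eq_zero_of_infinite_isRoot P
    ((Set.Ioi_infinite (0 : ℝ)).mono fun b hb => hroot b hb)
  refine LinearMap.pi_ext' fun j => LinearMap.ext_ring ?_
  have hj : (j : ℕ) ≠ 0 := fun h => hJ (h ▸ j.2)
  have hc : P.coeff ((j : ℕ) - 1) = f (Pi.single j 1) * (j : ℕ) := by
    simp only [P, Polynomial.finsetSum_coeff, Polynomial.coeff_monomial]
    rw [Finset.sum_eq_single j]
    · simp
    · intro i _ hi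
      have hi0 : (i : ℕ) ≠ 0 := fun h => hJ (h ▸ i.2)
      rw [if_neg]
      intro h
      exact hi (Subtype.ext (by omega))
    · simp
  rw [hP, Polynomial.coeff_zero] at hc
  have : f (Pi.single j 1) = 0 := by
    rcases mul_eq_zero.1 hc.symm with h | h
    · exact h
    · exact absurd (Nat.cast_eq_zero.1 h) hj
  simpa using this

/-- Finitely many pairs `(β, γ)` with prescribed differences of power sums. -/
theorem exists_pairs_power_sums (J : Finset ℕ) (hJ : 0 ∉ J) (k : ℕ) (hk : k ∈ J) :
    ∃ l : List (ℝ × ℝ), l.length ≤ J.card ∧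
      ∀ j ∈ J, (l.map fun x => x.2 ^ j - x.1 ^ j).sum = if j = k then 1 else 0 := by
  classical
  -- Extracting a basis from the velocities bounds the number of pairs by the dimension `J.card`.
  obtain ⟨s, hs, hspan, hli⟩ := exists_linearIndependent ℝ (Set.range fun b : Set.Ioi (0 : ℝ) =>
    fun j : J => ((j : ℕ) : ℝ) * (b : ℝ) ^ ((j : ℕ) - 1))
  rw [span_moment_velocity_eq_top J hJ] at hspan
  have : Fintype s := hli.setFinite.fintype
  have hcard : Fintype.card s ≤ J.card := by
    simpa using hli.fintype_card_le_finrank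
  choose β hβ using fun i : s => hs i.2
  -- At u = 0 the columns of the derivative are the chosen spanning velocities. `F` is thus a
  -- submersion there and covers a neighbourhood of 0, in particular some small δ e_k.
  let F : (s → ℝ) → (J → ℝ) := fun u j =>
    ∑ i, ((((β i : ℝ)) + u i) ^ (j : ℕ) - (β i : ℝ) ^ (j : ℕ))
  let F' : (s → ℝ) →L[ℝ] (J → ℝ) := ContinuousLinearMap.pi fun j =>
    ∑ i, (((j : ℕ) : ℝ) * (β i : ℝ) ^ ((j : ℕ) - 1)) • ContinuousLinearMap.proj (R := ℝ) i
  have hF : HasStrictFDerivAt F F' 0 := by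
    rw [hasStrictFDerivAt_pi]
    intro j
    refine HasStrictFDerivAt.fun_sum fun i _ => ?_
    have h1 : HasStrictFDerivAt (fun u : s → ℝ => (β i : ℝ) + u i)
        (ContinuousLinearMap.proj (R := ℝ) (φ := fun _ : s => ℝ) i) 0 :=
      (ContinuousLinearMap.proj (R := ℝ) (φ := fun _ : s => ℝ) i).hasStrictFDerivAt.const_add _
    have h2 := (h1.pow (j : ℕ)).sub_const ((β i : ℝ) ^ (j : ℕ))
    simpa [nsmul_eq_mul, mul_smul] using h2
  have hF0 : F 0 = 0 := by
    ext j; simp [F]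
  have hsurj : F'.range = ⊤ := by
    rw [eq_top_iff, ← hspan, Submodule.span_le]
    intro v hv
    refine ⟨Pi.single ⟨v, hv⟩ 1, ?_⟩
    ext j
    have := congrFun (hβ ⟨v, hv⟩) j
    simp only at this
    simp [F', Pi.single_apply, this]
  have hnhds := hF.map_nhds_eq_of_surj hsurj
  rw [hF0] at hnhds
  have himg : Set.range F ∈ 𝓝 (0 : J → ℝ) := by
    rw [← hnhds, ← Set.image_univ]; exact image_mem_map univ_mem
  have hline : ContinuousAt (fun δ : ℝ => δ • (Pi.single ⟨k, hk⟩ 1 : J → ℝ)) 0 := by fun_prop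
  have hev := (hline.preimage_mem_nhds (by simpa using himg))
  obtain ⟨δ, hδ, hδ0⟩ := nonempty_of_mem (inter_mem (mem_nhdsWithin_of_mem_nhds hev)
    (self_mem_nhdsWithin : Set.Ioi (0 : ℝ) ∈ 𝓝[>] (0 : ℝ)))
  obtain ⟨u, hFu⟩ := hδ
  have hδ0 : 0 < δ := hδ0
  have hk0 : k ≠ 0 := fun h => hJ (h ▸ hk)
  -- Dilating all points by τ multiplies the j-th sum by τ^j: zeros stay zero, and δ τ^k = 1.
  set τ : ℝ := (δ⁻¹) ^ ((k : ℝ)⁻¹) with hτ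
  have hτk : τ ^ k = δ⁻¹ := Real.rpow_inv_natCast_pow (inv_pos.2 hδ0).le hk0
  refine ⟨Finset.univ.toList.map fun i : s => (τ * β i, τ * (β i + u i)), by simpa using hcard, ?_⟩
  · intro j hj
    have h1 := congrFun hFu ⟨j, hj⟩
    simp only [F, Pi.smul_apply, Pi.single_apply, smul_eq_mul, Subtype.mk.injEq] at h1
    rw [List.map_map, Finset.sum_map_toList]
    simp only [Function.comp_def, mul_pow, ← mul_sub]
    rw [← Finset.mul_sum, h1]
    split_ifs with hjk
    · rw [hjk, hτk]; field_simp
    · simp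

/-! ### Asymptotic expansions at zero in a normed algebra -/

section Expansion

variable {𝔸 : Type*} [NormedRing 𝔸] [NormedAlgebra ℂ 𝔸]

theorem isBigO_pow_of_le {a b : ℕ} (h : a ≤ b) :
    (fun y : ℝ => y ^ b) =O[𝓝 0] fun y => y ^ a := by
  rcases h.eq_or_lt with rfl | h
  · exact isBigO_refl _ _
  · exact (isLittleO_pow_pow h).isBigO

variable {𝔹 : Type*} [NormedRing 𝔹]

theorem isBigO_mono_pow {f : ℝ → 𝔹} {a b : ℕ} (hf : f =O[𝓝 0] fun y : ℝ => y ^ b) (h : a ≤ b) :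
    f =O[𝓝 0] fun y : ℝ => y ^ a :=
  hf.trans (isBigO_pow_of_le h)

theorem isBigO_mul_pow {f g : ℝ → 𝔹} {a b c : ℕ} (hf : f =O[𝓝 0] fun y : ℝ => y ^ a)
    (hg : g =O[𝓝 0] fun y : ℝ => y ^ b) (h : c ≤ a + b) :
    (fun y => f y * g y) =O[𝓝 0] fun y : ℝ => y ^ c := by
  refine (hf.mul hg).trans ?_
  simp_rw [← pow_add]
  exact isBigO_pow_of_le h

theorem isBigO_pow_zero_of_continuousAt {f : ℝ → 𝔹} (hf : ContinuousAt f 0) :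
    f =O[𝓝 0] fun y : ℝ => y ^ 0 := by
  simp only [pow_zero]
  exact hf.norm.isBoundedUnder_le.isBigO_one ℝ

theorem isBigO_pow_smul (j : ℕ) (A : 𝔸) :
    (fun y : ℝ => ((y : ℂ) ^ j) • A) =O[𝓝 0] fun y : ℝ => y ^ j := by
  refine IsBigO.of_bound ‖A‖ (Eventually.of_forall fun y => ?_)
  rw [norm_smul, norm_pow, Complex.norm_real, norm_pow, mul_comm]

theorem isBigO_comp_mul {f : ℝ → 𝔹} {m : ℕ} (hf : f =O[𝓝 0] fun y : ℝ => y ^ m) (b : ℝ) :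
    (fun y => f (b * y)) =O[𝓝 0] fun y : ℝ => y ^ m := by
  have ht : Tendsto (fun y : ℝ => b * y) (𝓝 0) (𝓝 0) := by
    have : Continuous fun y : ℝ => b * y := by fun_prop
    simpa using this.tendsto 0
  refine (hf.comp_tendsto ht).trans ?_
  refine IsBigO.of_bound (|b| ^ m) (Eventually.of_forall fun y => ?_)
  simp [mul_pow]

/-- `f(y) = y ^ j A + O(y ^ (j + 1))` at zero. -/
def HasLeadingTerm (f : ℝ → 𝔸) (j : ℕ) (A : 𝔸) : Prop :=
  (fun y => f y - ((y : ℂ) ^ j) • A) =O[𝓝 0] fun y : ℝ => y ^ (j + 1)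

namespace HasLeadingTerm

variable {f g : ℝ → 𝔸} {i j : ℕ} {A B : 𝔸}

theorem isBigO (hf : HasLeadingTerm f j A) : f =O[𝓝 0] fun y : ℝ => y ^ j := by
  have := (isBigO_mono_pow hf (Nat.le_succ j)).add (isBigO_pow_smul j A)
  simpa using this

theorem add (hf : HasLeadingTerm f j A) (hg : HasLeadingTerm g j B) :
    HasLeadingTerm (fun y => f y + g y) j (A + B) := by
  refine (IsBigO.add hf hg).congr_left fun y => ?_
  rw [smul_add]; beta_reduce; abel

theorem neg (hf : HasLeadingTerm f j A) : HasLeadingTerm (fun y => -f y) j (-A) := by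
  refine (IsBigO.neg_left hf).congr_left fun y => ?_
  rw [smul_neg]; beta_reduce; abel

theorem sub (hf : HasLeadingTerm f j A) (hg : HasLeadingTerm g j B) :
    HasLeadingTerm (fun y => f y - g y) j (A - B) := by
  simpa only [sub_eq_add_neg] using hf.add hg.neg

theorem mul (hf : HasLeadingTerm f i A) (hg : HasLeadingTerm g j B) :
    HasLeadingTerm (fun y => f y * g y) (i + j) (A * B) := by
  have h1 := isBigO_mul_pow (c := i + j + 1) hf hg.isBigO (by omega)
  have h2 := isBigO_mul_pow (c := i + j + 1) (isBigO_pow_smul i A) hg (by omega)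
  refine (h1.add h2).congr_left fun y => ?_
  rw [sub_mul, mul_sub, pow_add, smul_mul_smul_comm]
  abel

theorem of_isBigO (hf : f =O[𝓝 0] fun y : ℝ => y ^ (j + 1)) : HasLeadingTerm f j 0 := by
  simpa [HasLeadingTerm] using hf

theorem const_mul (hf : HasLeadingTerm f j A) (c : 𝔸) :
    HasLeadingTerm (fun y => c * f y) j (c * A) := by
  refine (isBigO_mul_pow (c := j + 1) (isBigO_pow_zero_of_continuousAt
    (continuousAt_const (y := c))) hf (by omega)).congr_left fun y => ?_
  rw [mul_sub, mul_smul_comm]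

theorem mul_const (hf : HasLeadingTerm f j A) (c : 𝔸) :
    HasLeadingTerm (fun y => f y * c) j (A * c) := by
  refine (isBigO_mul_pow (c := j + 1) hf (isBigO_pow_zero_of_continuousAt
    (continuousAt_const (y := c))) (by omega)).congr_left fun y => ?_
  rw [sub_mul, smul_mul_assoc]

theorem comp_mul (hf : HasLeadingTerm f j A) (b : ℝ) :
    HasLeadingTerm (fun y => f (b * y)) j (((b : ℂ) ^ j) • A) := by
  refine (isBigO_comp_mul hf b).congr_left fun y => ?_
  rw [smul_smul, Complex.ofReal_mul, mul_pow, mul_comm ((y : ℂ) ^ j)]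

end HasLeadingTerm

/-- An analytic function that is O(y^b) is y^b times an analytic function g, and A = g(0). The
factors y are divided out one at a time by `dslope`. -/
theorem exists_hasLeadingTerm {f : ℝ → 𝔸} (hf : AnalyticAt ℝ f 0) {b : ℕ}
    (hb : f =O[𝓝 0] fun y : ℝ => y ^ b) : ∃ A, HasLeadingTerm f b A := by
  have key : ∀ n ≤ b, ∃ g : ℝ → 𝔸, AnalyticAt ℝ g 0 ∧ ∀ᶠ y in 𝓝 (0 : ℝ), f y = y ^ n • g y := by
    intro n
    induction n with
    | zero => exact fun _ => ⟨f, hf, Eventually.of_forall fun y => by simp⟩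
    | succ n ih =>
      intro hn
      obtain ⟨g, hg, hfg⟩ := ih (by omega)
      -- While n < b, the quotient f / y^n is still O(y) off zero, so continuity forces g(0) = 0.
      have hg0 : g 0 = 0 := by
        have h1 : ∀ᶠ y in 𝓝[≠] (0 : ℝ), y ≠ 0 := self_mem_nhdsWithin
        have h2 : g =O[𝓝[≠] 0] fun y : ℝ => y := by
          have h3 : (fun y => (y ^ n)⁻¹ • f y) =O[𝓝[≠] 0] fun y : ℝ => (y ^ n)⁻¹ • y ^ (n + 1) :=
            (isBigO_refl _ _).smul ((isBigO_mono_pow hb hn).mono nhdsWithin_le_nhds)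
          refine h3.congr' ?_ ?_
          · filter_upwards [h1, nhdsWithin_le_nhds hfg] with y hy hfy
            rw [hfy, smul_smul, inv_mul_cancel₀ (pow_ne_zero _ hy), one_smul]
          · filter_upwards [h1] with y hy
            rw [pow_succ, smul_eq_mul, inv_mul_cancel_left₀ (pow_ne_zero _ hy)]
        have h4 : Tendsto g (𝓝[≠] 0) (𝓝 0) :=
          h2.trans_tendsto (tendsto_id.mono_left nhdsWithin_le_nhds)
        exact tendsto_nhds_unique (hg.continuousAt.tendsto.mono_left nhdsWithin_le_nhds) h4
      obtain ⟨p, hp⟩ := hg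
      refine ⟨dslope g 0, ⟨_, hp.has_fpower_series_dslope_fslope⟩, ?_⟩
      filter_upwards [hfg] with y hy
      rw [hy, pow_succ, mul_smul]
      have := sub_smul_dslope g 0 y
      rw [hg0, sub_zero, sub_zero] at this
      rw [this]
  obtain ⟨g, hg, hfg⟩ := key b le_rfl
  refine ⟨g 0, ?_⟩
  have h1 : (fun y => g y - g 0) =O[𝓝 0] fun y : ℝ => y := by
    simpa using hg.differentiableAt.isBigO_sub
  have h2 : (fun y : ℝ => y ^ b • (g y - g 0)) =O[𝓝 0] fun y : ℝ => y ^ b • y :=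
    (isBigO_refl _ _).smul h1
  refine (h2.congr' ?_ (Eventually.of_forall fun y => by simp [pow_succ]))
  filter_upwards [hfg] with y hy
  rw [hy, smul_sub, ← Complex.ofReal_pow, Complex.coe_smul]

theorem analyticAt_ofReal_pow_smul (j : ℕ) (A : 𝔸) (x : ℝ) :
    AnalyticAt ℝ (fun y : ℝ => ((y : ℂ) ^ j) • A) x := by
  have : (fun y : ℝ => ((y : ℂ) ^ j) • A) = fun y : ℝ => (y ^ j) • A := by
    ext y; rw [← Complex.ofReal_pow, Complex.coe_smul]
  rw [this]
  exact (analyticAt_id.pow j).smul analyticAt_const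

theorem exists_expansion {f : ℝ → 𝔸} (hf : AnalyticAt ℝ f 0) {a b : ℕ} (hab : a ≤ b)
    (ha : f =O[𝓝 0] fun y : ℝ => y ^ a) :
    ∃ e : ℕ → 𝔸, (fun y : ℝ => f y - ∑ j ∈ Finset.Ico a b, ((y : ℂ) ^ j) • e j)
      =O[𝓝 0] fun y : ℝ => y ^ b := by
  induction b, hab using Nat.le_induction with
  | base => exact ⟨0, by simpa using ha⟩
  | succ b hab ih =>
    obtain ⟨e, he⟩ := ih
    have han : AnalyticAt ℝ (fun y : ℝ => f y - ∑ j ∈ Finset.Ico a b, ((y : ℂ) ^ j) • e j) 0 :=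
      hf.sub (Finset.analyticAt_fun_sum _ fun j _ => analyticAt_ofReal_pow_smul j (e j) 0)
    obtain ⟨A, hA⟩ := exists_hasLeadingTerm han he
    refine ⟨Function.update e b A, hA.congr_left fun y => ?_⟩
    rw [Finset.sum_Ico_succ_top hab, Function.update_self, sub_sub]
    congr 2
    refine Finset.sum_congr rfl fun j hj => ?_
    rw [Function.update_of_ne (Finset.mem_Ico.1 hj).2.ne]

end Expansion

/-! ### Approximations of one-parameter groups with error terms -/

section ExpExpansion

variable {𝔸 : Type*} [NormedRing 𝔸] [NormedAlgebra ℂ 𝔸] [CompleteSpace 𝔸]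

theorem analyticAt_exp_comp {f : ℝ → 𝔸} {x : ℝ} (hf : AnalyticAt ℝ f x) :
    AnalyticAt ℝ (fun y => NormedSpace.exp (f y)) x :=
  (NormedSpace.exp_analytic (𝕂 := ℝ) (f x)).comp hf

/-- The one-parameter group `exp (s y ^ k L)`. -/
noncomputable def expPow (L : 𝔸) (k : ℕ) (s y : ℝ) : 𝔸 :=
  NormedSpace.exp (((s : ℂ) * (y : ℂ) ^ k) • L)

theorem expPow_mul (L : 𝔸) (k : ℕ) (s s' y : ℝ) :
    expPow L k s y * expPow L k s' y = expPow L k (s + s') y := by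
  let _ := NormedAlgebra.restrictScalars ℚ ℂ 𝔸
  rw [expPow, expPow, expPow, ← NormedSpace.exp_add_of_commute, ← add_smul, Complex.ofReal_add,
    add_mul]
  exact ((Commute.refl L).smul_left _).smul_right _

@[simp] theorem expPow_zero (L : 𝔸) (k : ℕ) (y : ℝ) : expPow L k 0 y = 1 := by
  simp [expPow]

theorem expPow_comp_mul (L : 𝔸) (k : ℕ) (s b y : ℝ) :
    expPow L k s (b * y) = expPow L k (s * b ^ k) y := by
  simp [expPow, mul_pow, mul_assoc]

theorem analyticAt_expPow (L : 𝔸) (k : ℕ) (s x : ℝ) : AnalyticAt ℝ (expPow L k s) x := by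
  refine analyticAt_exp_comp ?_
  simp_rw [mul_comm (s : ℂ), mul_smul]
  exact analyticAt_ofReal_pow_smul k _ x

theorem expPow_sub_isBigO (L : 𝔸) {k : ℕ} (hk : k ≠ 0) (s : ℝ) :
    (fun y => expPow L k s y - 1 - ((y : ℂ) ^ k) • (s : ℂ) • L)
      =O[𝓝 0] fun y : ℝ => y ^ (k + 1) := by
  have h1 : (fun z : 𝔸 => NormedSpace.exp z - 1 - z) =O[𝓝 0] fun z => ‖z‖ ^ 2 := by
    have := (NormedSpace.exp_hasFPowerSeriesAt_zero (𝕂 := ℂ)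
      (𝔸 := 𝔸)).isBigO_sub_partialSum_pow 2
    refine this.congr_left fun z => ?_
    simp [FormalMultilinearSeries.partialSum, Finset.sum_range_succ,
      NormedSpace.expSeries_apply_eq, sub_sub]
  have ht : Tendsto (fun y : ℝ => ((s : ℂ) * (y : ℂ) ^ k) • L) (𝓝 0) (𝓝 0) := by
    have hc : Continuous fun y : ℝ => ((s : ℂ) * (y : ℂ) ^ k) • L := by fun_prop
    simpa [hk] using hc.tendsto 0
  refine ((h1.comp_tendsto ht).congr_left fun y => ?_).trans ?_
  · simp only [Function.comp, expPow]
    rw [smul_smul, mul_comm (s : ℂ)]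
  · have h2 : (fun y : ℝ => ((s : ℂ) * (y : ℂ) ^ k) • L) =O[𝓝 0] fun y : ℝ => y ^ k := by
      simpa only [mul_comm (s : ℂ), mul_smul] using isBigO_pow_smul k ((s : ℂ) • L)
    refine (h2.norm_left.pow 2).trans ?_
    simp_rw [← pow_mul]
    exact isBigO_pow_of_le (by omega)

theorem expPow_sub_one_isBigO (L : 𝔸) {k : ℕ} (hk : k ≠ 0) (s : ℝ) :
    (fun y => expPow L k s y - 1) =O[𝓝 0] fun y : ℝ => y ^ k :=
  HasLeadingTerm.isBigO (expPow_sub_isBigO L hk s)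

/-- `f(y) = exp (s y ^ k L) + Q(y) + O(y ^ m)` at zero. -/
def ExpApprox (L : 𝔸) (k m : ℕ) (s : ℝ) (Q f : ℝ → 𝔸) : Prop :=
  (fun y => f y - expPow L k s y - Q y) =O[𝓝 0] fun y : ℝ => y ^ m

namespace ExpApprox

variable {L : 𝔸} {k m a : ℕ} {s s' : ℝ} {Q Q' f g : ℝ → 𝔸}

/-- Errors add to first order: an error of order a meets exp(y^k L) - 1 = O(y^k) or another error of
order a, and a + k and 2a are both at least m. -/
theorem mul (hk : k ≠ 0) (h1 : m ≤ a + k) (h2 : m ≤ 2 * a)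
    (hQ : Q =O[𝓝 0] fun y : ℝ => y ^ a) (hQ' : Q' =O[𝓝 0] fun y : ℝ => y ^ a)
    (hf : ExpApprox L k m s Q f) (hg : ExpApprox L k m s' Q' g) :
    ExpApprox L k m (s + s') (fun y => Q y + Q' y) (fun y => f y * g y) := by
  have bE (s : ℝ) : expPow L k s =O[𝓝 0] fun y : ℝ => y ^ 0 :=
    isBigO_pow_zero_of_continuousAt (analyticAt_expPow L k s 0).continuousAt
  have bg : g =O[𝓝 0] fun y : ℝ => y ^ 0 := by
    have := ((isBigO_mono_pow hg (Nat.zero_le m)).add (bE s')).add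
      (isBigO_mono_pow hQ' (Nat.zero_le a))
    refine this.congr_left fun y => ?_
    abel
  have e1 := isBigO_mul_pow (c := m) hf bg (by omega)
  have e2 := isBigO_mul_pow (c := m) (bE s) hg (by omega)
  have e3 := isBigO_mul_pow (c := m) (isBigO_mono_pow hQ (Nat.le_refl a)) hg (by omega)
  have e4 := isBigO_mul_pow (c := m) hQ (expPow_sub_one_isBigO L hk s') h1
  have e5 := isBigO_mul_pow (c := m) (expPow_sub_one_isBigO L hk s) hQ' (by omega)
  have e6 := isBigO_mul_pow (c := m) hQ hQ' (by omega)
  refine (((((e1.add e2).add e3).add e4).add e5).add e6).congr_left fun y => ?_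
  rw [← expPow_mul]
  noncomm_ring

/-- By `mul`, exp(-s y^k L) - Q is a right inverse of f up to O(y^m). Multiplying on the left by the
exact inverse g, bounded near zero, identifies it with g. -/
theorem inv (hk : k ≠ 0) (h1 : m ≤ a + k) (h2 : m ≤ 2 * a)
    (hQ : Q =O[𝓝 0] fun y : ℝ => y ^ a) (hf : ExpApprox L k m s Q f)
    (hgc : ContinuousAt g 0) (hgf : ∀ y, g y * f y = 1) :
    ExpApprox L k m (-s) (fun y => -Q y) g := by
  have h : ExpApprox L k m (-s) (fun y => -Q y) (fun y => expPow L k (-s) y - Q y) := by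
    refine (isBigO_zero _ _).congr_left fun y => ?_
    beta_reduce
    abel
  have h3 := mul hk h1 h2 hQ hQ.neg_left hf h
  have h4 := isBigO_mul_pow (c := m) (isBigO_pow_zero_of_continuousAt hgc) h3 (by omega)
  refine h4.neg_left.congr_left fun y => ?_
  simp only [add_neg_cancel, expPow_zero, mul_sub, ← mul_assoc, hgf, one_mul, mul_zero, mul_one,
    sub_neg_eq_add]
  abel

theorem comp_mul (hf : ExpApprox L k m s Q f) (b : ℝ) :
    ExpApprox L k m (s * b ^ k) (fun y => Q (b * y)) (fun y => f (b * y)) := by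
  refine (isBigO_comp_mul hf b).congr_left fun y => ?_
  rw [expPow_comp_mul]

end ExpApprox

end ExpExpansion

/-! ### Scaling and inverting circuits -/

/-- The gate with its time multiplied by `x`. -/
noncomputable def Gate.scale (x : ℝ) : Gate → Gate
  | .sOne s => .sOne (x * s)
  | .qubit U => .qubit U
  | .vacuumFlip => .vacuumFlip

/-- The inverse gate. -/
noncomputable def Gate.inv : Gate → Gate
  | .sOne s => .sOne (-s)
  | .qubit U => .qubit U⁻¹
  | .vacuumFlip => .vacuumFlip

/-- The circuit with all its gate times multiplied by `x`. -/
noncomputable def Circuit.scale (x : ℝ) (c : Circuit) : Circuit := c.map (Gate.scale x)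

/-- The inverse circuit. -/
noncomputable def Circuit.inv (c : Circuit) : Circuit := (c.map Gate.inv).reverse

theorem Circuit.sOneCount_append (c d : Circuit) :
    Circuit.sOneCount (c ++ d) = Circuit.sOneCount c + Circuit.sOneCount d := by
  simp [Circuit.sOneCount]

theorem Circuit.sOneCount_scale (x : ℝ) (c : Circuit) :
    Circuit.sOneCount (Circuit.scale x c) = Circuit.sOneCount c := by
  have : Gate.sOneCost ∘ Gate.scale x = Gate.sOneCost := by
    ext g; cases g <;> rfl
  simp [Circuit.sOneCount, Circuit.scale, this]

theorem Circuit.sOneCount_inv (c : Circuit) :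
    Circuit.sOneCount (Circuit.inv c) = Circuit.sOneCount c := by
  have : Gate.sOneCost ∘ Gate.inv = Gate.sOneCost := by
    ext g; cases g <;> rfl
  simp [Circuit.sOneCount, Circuit.inv, this, List.map_reverse, List.sum_reverse]

theorem Circuit.vacuumFlip_notMem_scale {c : Circuit} (h : Gate.vacuumFlip ∉ c) (x : ℝ) :
    Gate.vacuumFlip ∉ Circuit.scale x c := by
  intro hm
  obtain ⟨g, hg, hgx⟩ := List.mem_map.1 hm
  cases g <;> simp_all [Gate.scale]

theorem Circuit.vacuumFlip_notMem_inv {c : Circuit} (h : Gate.vacuumFlip ∉ c) :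
    Gate.vacuumFlip ∉ Circuit.inv c := by
  intro hm
  obtain ⟨g, hg, hgx⟩ := List.mem_map.1 (List.mem_reverse.1 hm)
  cases g <;> simp_all [Gate.inv]

/-! ### Circuits in an abstract algebra and their leading terms -/

section Eval

variable {𝔸 : Type*} [NormedRing 𝔸] [NormedAlgebra ℂ 𝔸]

/-- A gate evaluated in an algebra: qubit operators act through `ρ`, the vacuum flip is `R`
and `S₁` is generated by `G`. -/
noncomputable def Gate.eval (ρ : Matrix (Fin 2) (Fin 2) ℂ →ₐ[ℂ] 𝔸) (R G : 𝔸) : Gate → 𝔸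
  | .sOne s => NormedSpace.exp ((Complex.I * (s : ℂ)) • G)
  | .qubit U => ρ U
  | .vacuumFlip => R

/-- A circuit evaluated in an algebra. -/
noncomputable def Circuit.eval (ρ : Matrix (Fin 2) (Fin 2) ℂ →ₐ[ℂ] 𝔸) (R G : 𝔸)
    (c : Circuit) : 𝔸 := (c.map (Gate.eval ρ R G)).prod

variable (ρ : Matrix (Fin 2) (Fin 2) ℂ →ₐ[ℂ] 𝔸) (R G : 𝔸)

@[simp] theorem Circuit.eval_nil : Circuit.eval ρ R G [] = 1 := by
  simp [Circuit.eval]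

theorem Circuit.eval_cons (g : Gate) (c : Circuit) :
    Circuit.eval ρ R G (g :: c) = Gate.eval ρ R G g * Circuit.eval ρ R G c := by
  simp [Circuit.eval]

theorem Circuit.eval_append (c d : Circuit) :
    Circuit.eval ρ R G (c ++ d) = Circuit.eval ρ R G c * Circuit.eval ρ R G d := by
  simp [Circuit.eval]

theorem Circuit.eval_scale (x : ℝ) (c : Circuit) :
    Circuit.eval ρ R G (Circuit.scale x c) = Circuit.eval ρ R ((x : ℂ) • G) c := by
  have : Gate.eval ρ R G ∘ Gate.scale x = Gate.eval ρ R ((x : ℂ) • G) := by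
    ext g
    cases g
    · simp only [Function.comp, Gate.scale, Gate.eval, smul_smul]
      congr 2; push_cast; ring
    · rfl
    · rfl
  simp [Circuit.eval, Circuit.scale, this]

variable {R} [CompleteSpace 𝔸]

theorem Gate.eval_inv_mul (hR : R * R = 1) (g : Gate) :
    Gate.eval ρ R G (Gate.inv g) * Gate.eval ρ R G g = 1 ∧
      Gate.eval ρ R G g * Gate.eval ρ R G (Gate.inv g) = 1 := by
  cases g with
  | sOne s =>
    let _ := NormedAlgebra.restrictScalars ℚ ℂ 𝔸
    have hc : Commute ((Complex.I * (s : ℂ)) • G) (-((Complex.I * (s : ℂ)) • G)) :=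
      (Commute.refl _).neg_right
    simp only [Gate.inv, Gate.eval, Complex.ofReal_neg, mul_neg, neg_smul]
    rw [← NormedSpace.exp_add_of_commute hc, ← NormedSpace.exp_add_of_commute hc.symm]
    simp
  | qubit U =>
    simp only [Gate.inv, Gate.eval, ← map_mul]
    constructor
    · rw [← Submonoid.coe_mul, inv_mul_cancel]; simp
    · rw [← Submonoid.coe_mul, mul_inv_cancel]; simp
  | vacuumFlip => simp [Gate.inv, Gate.eval, hR]

theorem Circuit.eval_inv_mul (hR : R * R = 1) (c : Circuit) :
    Circuit.eval ρ R G (Circuit.inv c) * Circuit.eval ρ R G c = 1 ∧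
      Circuit.eval ρ R G c * Circuit.eval ρ R G (Circuit.inv c) = 1 := by
  induction c with
  | nil => simp [Circuit.inv]
  | cons g c ih =>
    have h : Circuit.inv (g :: c) = Circuit.inv c ++ [Gate.inv g] := by simp [Circuit.inv]
    obtain ⟨h1, h2⟩ := Gate.eval_inv_mul ρ G hR g
    rw [h, Circuit.eval_append, Circuit.eval_cons, Circuit.eval_cons, Circuit.eval_nil, mul_one]
    constructor
    · rw [mul_assoc, ← mul_assoc (Gate.eval ρ R G (Gate.inv g)), h1, one_mul, ih.1]
    · rw [mul_assoc, ← mul_assoc (Circuit.eval ρ R G c), ih.2, one_mul, h2]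

theorem Circuit.eval_analyticAt (c : Circuit) (x : ℝ) :
    AnalyticAt ℝ (fun y : ℝ => Circuit.eval ρ R ((y : ℂ) • G) c) x := by
  induction c with
  | nil => simpa using analyticAt_const
  | cons g c ih =>
    simp_rw [Circuit.eval_cons]
    refine AnalyticAt.mul ?_ ih
    cases g with
    | sOne s =>
      simp only [Gate.eval]
      refine analyticAt_exp_comp ?_
      have := analyticAt_ofReal_pow_smul 1 ((Complex.I * (s : ℂ)) • G) x
      simpa only [pow_one, smul_smul, mul_comm] using this
    | qubit U => exact analyticAt_const
    | vacuumFlip => exact analyticAt_const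

/-- Some circuit without vacuum flips and with at most `N` gates `S₁` equals
`1 + y ^ j A + O(y ^ (j + 1))` when all its gate times are multiplied by `y`. -/
def HasCircuit (ρ : Matrix (Fin 2) (Fin 2) ℂ →ₐ[ℂ] 𝔸) (R G : 𝔸) (j : ℕ) (A : 𝔸) (N : ℕ) :
    Prop :=
  ∃ c : Circuit, Gate.vacuumFlip ∉ c ∧ Circuit.sOneCount c ≤ N ∧
    HasLeadingTerm (fun y : ℝ => Circuit.eval ρ R ((y : ℂ) • G) c - 1) j A

namespace HasCircuit

variable {ρ G} {i j : ℕ} {A B : 𝔸} {N N' : ℕ}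

theorem mono (h : HasCircuit ρ R G j A N) (hN : N ≤ N') : HasCircuit ρ R G j A N' := by
  obtain ⟨c, h1, h2, h3⟩ := h
  exact ⟨c, h1, h2.trans hN, h3⟩

theorem add (hj : j ≠ 0) (hA : HasCircuit ρ R G j A N) (hB : HasCircuit ρ R G j B N') :
    HasCircuit ρ R G j (A + B) (N + N') := by
  obtain ⟨c, c1, c2, c3⟩ := hA
  obtain ⟨d, d1, d2, d3⟩ := hB
  refine ⟨c ++ d, by simp [c1, d1], by rw [Circuit.sOneCount_append]; omega, ?_⟩
  have h := (c3.add d3).add (HasLeadingTerm.of_isBigO (j := j)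
    (isBigO_mul_pow c3.isBigO d3.isBigO (by omega)))
  rw [add_zero] at h
  convert h using 2 with y
  rw [Circuit.eval_append]
  noncomm_ring

theorem scale (hA : HasCircuit ρ R G j A N) (b : ℝ) :
    HasCircuit ρ R G j (((b : ℂ) ^ j) • A) N := by
  obtain ⟨c, c1, c2, c3⟩ := hA
  refine ⟨Circuit.scale b c, Circuit.vacuumFlip_notMem_scale c1 b,
    by rwa [Circuit.sOneCount_scale], ?_⟩
  convert c3.comp_mul b using 3 with y
  rw [Circuit.eval_scale, smul_smul, Complex.ofReal_mul]

/-- Multiplying the times by r^(1/j) multiplies the leading coefficient by r, so positive factors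
cost no gates. -/
theorem smul_pos (hj : j ≠ 0) (hA : HasCircuit ρ R G j A N) {r : ℝ} (hr : 0 ≤ r) :
    HasCircuit ρ R G j ((r : ℂ) • A) N := by
  have := hA.scale (r ^ ((j : ℝ)⁻¹))
  rwa [← Complex.ofReal_pow, Real.rpow_inv_natCast_pow hr hj] at this

/-- Qubit gates are untouched by time scaling, so conjugation passes directly to the leading
coefficient. -/
theorem conj (hA : HasCircuit ρ R G j A N) (U : Matrix.unitaryGroup (Fin 2) ℂ) :
    HasCircuit ρ R G j (ρ U * A * ρ (star (U : Matrix (Fin 2) (Fin 2) ℂ))) N := by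
  obtain ⟨c, c1, c2, c3⟩ := hA
  refine ⟨[Gate.qubit U] ++ c ++ [Gate.qubit U⁻¹], by simp [c1], ?_, ?_⟩
  · rw [Circuit.sOneCount_append, Circuit.sOneCount_append]
    simpa [Circuit.sOneCount, Gate.sOneCost] using c2
  · have h : ρ U * ρ (star (U : Matrix (Fin 2) (Fin 2) ℂ)) = 1 := by
      rw [← map_mul, Unitary.mul_star_self_of_mem U.2, map_one]
    convert (c3.const_mul (ρ U)).mul_const (ρ (star (U : Matrix (Fin 2) (Fin 2) ℂ))) using 2 with y
    rw [Circuit.eval_append, Circuit.eval_append]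
    simp only [Circuit.eval_cons, Circuit.eval_nil, mul_one, Gate.eval]
    rw [mul_sub, sub_mul, mul_one, h]
    rfl

theorem eval_inv_hasLeadingTerm (hR : R * R = 1) {c : Circuit} (hj : j ≠ 0)
    (hc : HasLeadingTerm (fun y : ℝ => Circuit.eval ρ R ((y : ℂ) • G) c - 1) j A) :
    HasLeadingTerm (fun y : ℝ => Circuit.eval ρ R ((y : ℂ) • G) (Circuit.inv c)) 0 1 := by
  have h1 := isBigO_pow_zero_of_continuousAt
    (Circuit.eval_analyticAt (R := R) ρ G (Circuit.inv c) 0).continuousAt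
  have h2 := isBigO_mul_pow (c := 0 + 1) h1 hc.isBigO (by omega)
  refine h2.neg_left.congr_left fun y => ?_
  rw [mul_sub, (Circuit.eval_inv_mul ρ _ hR c).1]
  simp

/-- V W V⁻¹ W⁻¹ - 1 = (VW - WV) V⁻¹ W⁻¹. The commutator does not change when 1 is subtracted from V
and W, so it starts at order i + j; the remaining factor is 1 + O(y). -/
theorem bracket (hR : R * R = 1) (hi : i ≠ 0) (hj : j ≠ 0) (hA : HasCircuit ρ R G i A N)
    (hB : HasCircuit ρ R G j B N') :
    HasCircuit ρ R G (i + j) (A * B - B * A) (2 * N + 2 * N') := by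
  obtain ⟨c, c1, c2, c3⟩ := hA
  obtain ⟨d, d1, d2, d3⟩ := hB
  refine ⟨c ++ d ++ (Circuit.inv c ++ Circuit.inv d), ?_, ?_, ?_⟩
  · have := Circuit.vacuumFlip_notMem_inv c1
    have := Circuit.vacuumFlip_notMem_inv d1
    simp_all
  · simp only [Circuit.sOneCount_append, Circuit.sOneCount_inv]; omega
  · have h1 := c3.mul d3
    have h2 := d3.mul c3
    rw [add_comm j i] at h2
    have h3 := (h1.sub h2).mul ((eval_inv_hasLeadingTerm hR hi c3).mul
      (eval_inv_hasLeadingTerm hR hj d3))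
    simp only [add_zero, mul_one] at h3
    convert h3 using 2 with y
    obtain ⟨e1, e2⟩ := Circuit.eval_inv_mul ρ ((y : ℂ) • G) hR c
    obtain ⟨e3, e4⟩ := Circuit.eval_inv_mul ρ ((y : ℂ) • G) hR d
    simp only [Circuit.eval_append]
    generalize Circuit.eval ρ R ((y : ℂ) • G) c = V at *
    generalize Circuit.eval ρ R ((y : ℂ) • G) d = W at *
    generalize Circuit.eval ρ R ((y : ℂ) • G) (Circuit.inv c) = V' at *
    generalize Circuit.eval ρ R ((y : ℂ) • G) (Circuit.inv d) = W' at *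
    have h4 : W * V * (V' * W') = 1 := by
      rw [mul_assoc, ← mul_assoc V, e2, one_mul, e4]
    calc V * W * (V' * W') - 1 = V * W * (V' * W') - W * V * (V' * W') := by rw [h4]
      _ = _ := by noncomm_ring

end HasCircuit

end Eval

/-! ### Qubit matrices -/

/-- The qubit lowering operator `|1⟩⟨0|`. -/
def lower : Matrix (Fin 2) (Fin 2) ℂ := Matrix.single 1 0 1

theorem lower_eq : lower = !![0, 0; 1, 0] := by
  ext i j
  fin_cases i <;> fin_cases j <;> simp [lower]

/-- The Hadamard gate. -/
noncomputable def hadamard : Matrix.unitaryGroup (Fin 2) ℂ :=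
  ⟨((Real.sqrt 2 : ℝ) : ℂ)⁻¹ • !![1, 1; 1, -1], by
    have h2 : (((Real.sqrt 2 : ℝ) : ℂ)⁻¹) * (((Real.sqrt 2 : ℝ) : ℂ)⁻¹) = 1 / 2 := by
      rw [← mul_inv, ← Complex.ofReal_mul, Real.mul_self_sqrt (by norm_num)]
      norm_num
    rw [Matrix.mem_unitaryGroup_iff, Matrix.star_eq_conjTranspose, Matrix.conjTranspose_smul,
      smul_mul_smul_comm]
    simp only [star_inv₀, RCLike.star_def, Complex.conj_ofReal, h2]
    ext i j
    fin_cases i <;> fin_cases j <;> simp [Matrix.vecMul, dotProduct, Fin.sum_univ_two] <;> norm_num⟩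

/-- The Pauli `X` gate. -/
noncomputable def pauliX : Matrix.unitaryGroup (Fin 2) ℂ :=
  ⟨!![0, 1; 1, 0], by
    rw [Matrix.mem_unitaryGroup_iff, Matrix.star_eq_conjTranspose]
    ext i j
    fin_cases i <;> fin_cases j <;> simp [Matrix.mul_apply, Fin.sum_univ_two]⟩

/-- The phase gate `diag (1, w)`. -/
noncomputable def phaseGate (w : ℂ) (hw : star w * w = 1) : Matrix.unitaryGroup (Fin 2) ℂ :=
  ⟨!![1, 0; 0, w], by
    rw [Matrix.mem_unitaryGroup_iff', Matrix.star_eq_conjTranspose]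
    ext i j
    fin_cases i <;> fin_cases j <;> simp_all [Matrix.mul_apply, Fin.sum_univ_two]⟩

theorem phaseGate_conj_lower (w : ℂ) (hw : star w * w = 1) :
    (phaseGate w hw : Matrix (Fin 2) (Fin 2) ℂ) * lower
      * star (phaseGate w hw : Matrix (Fin 2) (Fin 2) ℂ) = w • lower := by
  rw [Matrix.star_eq_conjTranspose]
  ext i j
  fin_cases i <;> fin_cases j <;>
    simp [phaseGate, lower_eq, Matrix.vecMul, dotProduct, Fin.sum_univ_two]

/-- The nilpotent `lower` is not conjugate to a multiple of Z, but w (|1⟩⟨0| + |0⟩⟨1|) = wX is a sum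
of two conjugates, and the Hadamard gate turns X into Z. -/
theorem hadamard_conj_add (w : ℂ) (hw : star w * w = 1) :
    ((hadamard * phaseGate w hw : Matrix.unitaryGroup (Fin 2) ℂ) : Matrix (Fin 2) (Fin 2) ℂ)
        * lower * star ((hadamard * phaseGate w hw : Matrix.unitaryGroup (Fin 2) ℂ) :
          Matrix (Fin 2) (Fin 2) ℂ)
      + ((hadamard * (pauliX * phaseGate w hw) : Matrix.unitaryGroup (Fin 2) ℂ) :
          Matrix (Fin 2) (Fin 2) ℂ)
        * lower * star ((hadamard * (pauliX * phaseGate w hw) : Matrix.unitaryGroup (Fin 2) ℂ) :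
          Matrix (Fin 2) (Fin 2) ℂ) = w • !![1, 0; 0, -1] := by
  have h2 : (((Real.sqrt 2 : ℝ) : ℂ)⁻¹) * (((Real.sqrt 2 : ℝ) : ℂ)⁻¹) = 1 / 2 := by
    rw [← mul_inv, ← Complex.ofReal_mul, Real.mul_self_sqrt (by norm_num)]
    norm_num
  have hH : star (hadamard : Matrix (Fin 2) (Fin 2) ℂ) = hadamard := by
    rw [Matrix.star_eq_conjTranspose]
    ext i j
    fin_cases i <;> fin_cases j <;> simp [hadamard]
  have hX : star (pauliX : Matrix (Fin 2) (Fin 2) ℂ) = pauliX := by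
    rw [Matrix.star_eq_conjTranspose]
    ext i j
    fin_cases i <;> fin_cases j <;> simp [pauliX]
  have e1 : ∀ A P S : Matrix (Fin 2) (Fin 2) ℂ, (A * P) * lower * (S * A) =
      A * (P * lower * S) * A := fun A P S => by simp only [mul_assoc]
  have e2 : ∀ A B P S : Matrix (Fin 2) (Fin 2) ℂ, (A * (B * P)) * lower * ((S * B) * A) =
      A * (B * (P * lower * S) * B) * A := fun A B P S => by simp only [mul_assoc]
  simp only [Submonoid.coe_mul, star_mul, hH, hX]
  rw [e1, e2, phaseGate_conj_lower]
  have h3 : (hadamard : Matrix (Fin 2) (Fin 2) ℂ) = ((Real.sqrt 2 : ℝ) : ℂ)⁻¹ • !![1, 1; 1, -1] :=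
    rfl
  rw [h3]
  simp only [smul_mul_assoc, mul_smul_comm, smul_smul]
  rw [← smul_add]
  ext i j
  fin_cases i <;> fin_cases j <;>
    simp [pauliX, lower_eq] <;> ring_nf at h2 ⊢ <;>
    simp [h2] <;> ring

theorem lower_commutator :
    lower * !![1, 0; 0, -1] - !![1, 0; 0, -1] * lower = (2 : ℂ) • lower := by
  ext i j
  fin_cases i <;> fin_cases j <;>
    simp [lower_eq]; norm_num

/-! ### Leading order circuits for powers of the ladder operators -/

section Ladder

variable {𝔸 : Type*} [NormedRing 𝔸] [NormedAlgebra ℂ 𝔸]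

/-- The generator `i (Mᴴ b' ^ j + M b ^ j)`. -/
noncomputable def ladder (ρ : Matrix (Fin 2) (Fin 2) ℂ →ₐ[ℂ] 𝔸) (b b' : 𝔸)
    (M : Matrix (Fin 2) (Fin 2) ℂ) (j : ℕ) : 𝔸 :=
  Complex.I • (ρ Mᴴ * b' ^ j + ρ M * b ^ j)

variable {ρ : Matrix (Fin 2) (Fin 2) ℂ →ₐ[ℂ] 𝔸} {b b' : 𝔸}

theorem ladder_add (M N : Matrix (Fin 2) (Fin 2) ℂ) (j : ℕ) :
    ladder ρ b b' (M + N) j = ladder ρ b b' M j + ladder ρ b b' N j := by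
  simp only [ladder, Matrix.conjTranspose_add, map_add, add_mul, ← smul_add]
  congr 1; abel

theorem ladder_ofReal_smul (r : ℝ) (M : Matrix (Fin 2) (Fin 2) ℂ) (j : ℕ) :
    ladder ρ b b' ((r : ℂ) • M) j = (r : ℂ) • ladder ρ b b' M j := by
  simp only [ladder, Matrix.conjTranspose_smul, map_smul, smul_mul_assoc, RCLike.star_def,
    Complex.conj_ofReal, ← smul_add]
  rw [smul_comm]

theorem ladder_conj (hb : ∀ M, Commute (ρ M) b) (hb' : ∀ M, Commute (ρ M) b')
    (U M : Matrix (Fin 2) (Fin 2) ℂ) (j : ℕ) :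
    ρ U * ladder ρ b b' M j * ρ (star U) = ladder ρ b b' (U * M * star U) j := by
  have h1 : (U * M * star U)ᴴ = U * Mᴴ * star U := by
    simp [Matrix.star_eq_conjTranspose, mul_assoc]
  have h2 : b' ^ j * ρ (star U) = ρ (star U) * b' ^ j := ((hb' (star U)).pow_right j).eq.symm
  have h3 : b ^ j * ρ (star U) = ρ (star U) * b ^ j := ((hb (star U)).pow_right j).eq.symm
  simp only [ladder, h1, map_mul, mul_smul_comm, smul_mul_assoc, mul_add, add_mul]
  simp only [mul_assoc, h2, h3]

/-- Replacing (M, N) by (iM, -iN) fixes MN and Mᴴ Nᴴ but negates M Nᴴ and Mᴴ N. The sum of both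
brackets doubles the pure powers and loses the mixed ones, whatever the commutator of b and b'. -/
theorem ladder_bracket (hb : ∀ M, Commute (ρ M) b) (hb' : ∀ M, Commute (ρ M) b')
    (M N : Matrix (Fin 2) (Fin 2) ℂ) (i l : ℕ) :
    (ladder ρ b b' M i * ladder ρ b b' N l - ladder ρ b b' N l * ladder ρ b b' M i) +
      (ladder ρ b b' (Complex.I • M) i * ladder ρ b b' (-Complex.I • N) l
        - ladder ρ b b' (-Complex.I • N) l * ladder ρ b b' (Complex.I • M) i) =
      (2 : ℂ) • ladder ρ b b' (Complex.I • (M * N - N * M)) (i + l) := by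
  have e (x y : 𝔸) (j : ℕ) (P Q : Matrix (Fin 2) (Fin 2) ℂ) (m : ℕ)
      (h : Commute (ρ Q) x) : ρ P * x ^ j * (ρ Q * y ^ m) = ρ (P * Q) * (x ^ j * y ^ m) := by
    rw [map_mul, (h.symm.pow_left j).mul_mul_mul_comm]
  have ea (P Q : Matrix (Fin 2) (Fin 2) ℂ) (j m : ℕ) := e b b j P Q m (hb Q)
  have eb (P Q : Matrix (Fin 2) (Fin 2) ℂ) (j m : ℕ) := e b b' j P Q m (hb Q)
  have ec (P Q : Matrix (Fin 2) (Fin 2) ℂ) (j m : ℕ) := e b' b j P Q m (hb' Q)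
  have ed (P Q : Matrix (Fin 2) (Fin 2) ℂ) (j m : ℕ) := e b' b' j P Q m (hb' Q)
  have hprod (M N : Matrix (Fin 2) (Fin 2) ℂ) (i l : ℕ) :
      ladder ρ b b' M i * ladder ρ b b' N l = -(ρ (Mᴴ * Nᴴ) * b' ^ (i + l)
        + ρ (Mᴴ * N) * (b' ^ i * b ^ l) + ρ (M * Nᴴ) * (b ^ i * b' ^ l)
        + ρ (M * N) * b ^ (i + l)) := by
    simp only [ladder, smul_mul_smul_comm, Complex.I_mul_I, mul_add, add_mul, ea, eb, ec, ed,
      ← pow_add, neg_smul, one_smul]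
    abel
  have hM : (Complex.I • M)ᴴ = -Complex.I • Mᴴ := by simp [Matrix.conjTranspose_smul]
  have hN : (-Complex.I • N)ᴴ = Complex.I • Nᴴ := by simp [Matrix.conjTranspose_smul]
  have hMN : (Complex.I • (M * N - N * M))ᴴ = -Complex.I • (Nᴴ * Mᴴ - Mᴴ * Nᴴ) := by
    simp [Matrix.conjTranspose_smul]
  rw [hprod, hprod, hprod, hprod, hM, hN, ladder, hMN, add_comm l i]
  simp only [mul_smul_comm, map_smul, map_sub, map_neg, sub_mul, smul_mul_assoc, neg_mul, mul_neg,
    Complex.I_mul_I, neg_neg, one_smul, smul_smul, smul_sub, smul_add, neg_smul, smul_neg]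
  module

variable [CompleteSpace 𝔸] {R : 𝔸}

/-- The leading order circuit for the `k`-th power is built by halving `k`. -/
theorem hasCircuit_ladder (hR : R * R = 1) (hb : ∀ M, Commute (ρ M) b)
    (hb' : ∀ M, Commute (ρ M) b') (n k : ℕ) (hk : 1 ≤ k) (hkn : k ≤ 2 ^ n) :
    HasCircuit ρ R (ρ lowerᴴ * b' + ρ lower * b) k (ladder ρ b b' lower k) (12 ^ n) := by
  set G := ρ lowerᴴ * b' + ρ lower * b with hG
  have hone : HasCircuit ρ R G 1 (ladder ρ b b' lower 1) 1 := by
    refine ⟨[Gate.sOne 1], by simp, by simp [Circuit.sOneCount, Gate.sOneCost], ?_⟩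
    have := expPow_sub_isBigO (Complex.I • G) one_ne_zero 1
    refine this.congr_left fun y => ?_
    simp only [Circuit.eval_cons, Circuit.eval_nil, Gate.eval, expPow, ladder, hG, smul_smul,
      Complex.ofReal_one, one_mul, mul_one, pow_one, mul_comm Complex.I]
  have hconj {j N : ℕ} {M : Matrix (Fin 2) (Fin 2) ℂ}
      (h : HasCircuit ρ R G j (ladder ρ b b' M j) N) (U : Matrix.unitaryGroup (Fin 2) ℂ) :
      HasCircuit ρ R G j (ladder ρ b b' ((U : Matrix (Fin 2) (Fin 2) ℂ) * M *
        star (U : Matrix (Fin 2) (Fin 2) ℂ)) j) N := by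
    rw [← ladder_conj hb hb']
    exact h.conj U
  have hphase {j N : ℕ} (h : HasCircuit ρ R G j (ladder ρ b b' lower j) N) (w : ℂ)
      (hw : star w * w = 1) : HasCircuit ρ R G j (ladder ρ b b' (w • lower) j) N := by
    rw [← phaseGate_conj_lower w hw]
    exact hconj h _
  have hZ {j N : ℕ} (hj : j ≠ 0) (h : HasCircuit ρ R G j (ladder ρ b b' lower j) N) (w : ℂ)
      (hw : star w * w = 1) :
      HasCircuit ρ R G j (ladder ρ b b' (w • !![1, 0; 0, -1]) j) (N + N) := by
    rw [← hadamard_conj_add w hw, ladder_add]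
    exact (hconj h _).add hj (hconj h _)
  induction n generalizing k with
  | zero =>
    obtain rfl : k = 1 := by simp at hkn; omega
    exact hone
  | succ n ih =>
    rcases hk.eq_or_lt with rfl | hk1
    · exact hone.mono (Nat.one_le_pow _ _ (by norm_num))
    obtain ⟨i, l, hi, hl, rfl, hi2, hl2⟩ : ∃ i l, 1 ≤ i ∧ 1 ≤ l ∧ i + l = k ∧ i ≤ 2 ^ n ∧
        l ≤ 2 ^ n := by
      rw [pow_succ] at hkn
      exact ⟨k / 2, k - k / 2, by omega, by omega, by omega, by omega, by omega⟩
    have h1 := ih i hi hi2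
    have h2 := ih l hl hl2
    have hi0 : i ≠ 0 := by omega
    have hl0 : l ≠ 0 := by omega
    have hI : star Complex.I * Complex.I = 1 := by simp
    have hI' : star (-Complex.I) * (-Complex.I) = 1 := by simp
    have hz := hZ hl0 h2 1 (by simp)
    rw [one_smul] at hz
    -- The bracket uses M = `lower` and N = Z, with [M, N] = 2 M. Z costs two copies of the
    -- l-circuit.
    have h3 := (h1.bracket hR hi0 hl0 hz).add (by omega)
      ((hphase h1 Complex.I hI).bracket hR hi0 hl0 (hZ hl0 h2 (-Complex.I) hI'))
    rw [ladder_bracket hb hb', lower_commutator] at h3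
    -- The factor 1/4 removes the 2 from `ladder_bracket` and the 2 from `lower_commutator`; the
    -- phase gate removes the remaining i.
    have h4 := (h3.smul_pos (by omega) (r := 1 / 4) (by norm_num)).conj
      (phaseGate (-Complex.I) hI')
    have h5 : Complex.I • (2 : ℂ) • lower = ((2 : ℝ) : ℂ) • Complex.I • lower := by
      rw [smul_comm]; norm_num
    -- With N gates for each half, each bracket costs 2 N + 2 (2 N) = 6 N, hence the 12.
    have h6 := h4.mono (N' := 12 ^ (n + 1)) (le_of_eq (by ring))
    rw [h5, ladder_ofReal_smul, smul_smul, smul_smul, mul_smul_comm, smul_mul_assoc,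
      ladder_conj hb hb', mul_smul_comm, smul_mul_assoc, phaseGate_conj_lower, smul_smul] at h6
    norm_num at h6
    exact h6

end Ladder

/-! ### Raising the order of an approximation -/

section OrderRaising

variable {𝔸 : Type*} [NormedRing 𝔸] [NormedAlgebra ℂ 𝔸] [CompleteSpace 𝔸]
  {ρ : Matrix (Fin 2) (Fin 2) ℂ →ₐ[ℂ] 𝔸} {R G L : 𝔸}

/-- The product of `c(γ y) c(β y)⁻¹` over pairs `(β, γ)`. -/
noncomputable def Circuit.ratios (c : Circuit) (l : List (ℝ × ℝ)) : Circuit :=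
  l.flatMap fun x => Circuit.scale x.2 c ++ Circuit.inv (Circuit.scale x.1 c)

theorem Circuit.sOneCount_ratios (c : Circuit) (l : List (ℝ × ℝ)) :
    Circuit.sOneCount (Circuit.ratios c l) = 2 * l.length * Circuit.sOneCount c := by
  induction l with
  | nil => simp [Circuit.ratios, Circuit.sOneCount]
  | cons x l ih =>
    have : Circuit.ratios c (x :: l) = (Circuit.scale x.2 c ++ Circuit.inv (Circuit.scale x.1 c))
      ++ Circuit.ratios c l := by simp [Circuit.ratios]
    rw [this, sOneCount_append, sOneCount_append, sOneCount_inv, sOneCount_scale, sOneCount_scale,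
      ih, List.length_cons]
    ring

theorem Circuit.vacuumFlip_notMem_ratios {c : Circuit} (hc : Gate.vacuumFlip ∉ c)
    (l : List (ℝ × ℝ)) : Gate.vacuumFlip ∉ Circuit.ratios c l := by
  simp only [ratios, List.mem_flatMap, List.mem_append, not_exists, not_and, not_or]
  exact fun x _ => ⟨vacuumFlip_notMem_scale hc _,
    vacuumFlip_notMem_inv (vacuumFlip_notMem_scale hc _)⟩

theorem Circuit.ratios_expApprox (hR : R * R = 1) {k a m : ℕ} (hk : k ≠ 0) (h1 : m ≤ a + k)
    (h2 : m ≤ 2 * a) (e : ℕ → 𝔸) {c : Circuit}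
    (hc : ExpApprox L k m 1 (fun y => ∑ j ∈ Finset.Ico a m, ((y : ℂ) ^ j) • e j)
      (fun y : ℝ => Circuit.eval ρ R ((y : ℂ) • G) c)) (l : List (ℝ × ℝ)) :
    ExpApprox L k m (l.map fun x => x.2 ^ k - x.1 ^ k).sum
      (fun y => ∑ j ∈ Finset.Ico a m, ((y : ℂ) ^ j) •
        (((l.map fun x => x.2 ^ j - x.1 ^ j).sum : ℝ) : ℂ) • e j)
      (fun y : ℝ => Circuit.eval ρ R ((y : ℂ) • G) (Circuit.ratios c l)) := by
  have bQ (e : ℕ → 𝔸) : (fun y : ℝ => ∑ j ∈ Finset.Ico a m, ((y : ℂ) ^ j) • e j)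
      =O[𝓝 0] fun y : ℝ => y ^ a :=
    IsBigO.fun_sum fun j hj => isBigO_mono_pow (isBigO_pow_smul j (e j)) (Finset.mem_Ico.1 hj).1
  have hsc (b : ℝ) : ExpApprox L k m (b ^ k)
      (fun y => ∑ j ∈ Finset.Ico a m, ((y : ℂ) ^ j) • ((b : ℂ) ^ j) • e j)
      (fun y : ℝ => Circuit.eval ρ R ((y : ℂ) • G) (Circuit.scale b c)) := by
    convert hc.comp_mul b using 1
    · rw [one_mul]
    · ext y
      refine Finset.sum_congr rfl fun j _ => ?_
      rw [smul_smul, Complex.ofReal_mul, mul_pow, mul_comm]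
    · ext y
      rw [Circuit.eval_scale, smul_smul, Complex.ofReal_mul]
  induction l with
  | nil => simp [ratios, ExpApprox, isBigO_zero]
  | cons x l ih =>
    have hinv := (hsc x.1).inv hk h1 h2 (bQ _)
      (Circuit.eval_analyticAt (R := R) ρ G (Circuit.inv (Circuit.scale x.1 c)) 0).continuousAt
      (fun y => (Circuit.eval_inv_mul ρ _ hR _).1)
    have hp := (((hsc x.2).mul hk h1 h2 (bQ _) (bQ _).neg_left hinv).mul hk h1 h2
      ((bQ _).add (bQ _).neg_left) (bQ _) ih)
    convert hp using 1
    · simp [sub_eq_add_neg]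
    · ext y
      rw [← sub_eq_add_neg, ← Finset.sum_sub_distrib, ← Finset.sum_add_distrib]
      refine Finset.sum_congr rfl fun j _ => ?_
      rw [List.map_cons, List.sum_cons]
      push_cast
      module
    · ext y
      simp [ratios, Circuit.eval_append, mul_assoc]

/-- Raising the order of an approximation by `k`. -/
theorem exists_circuit_order_add (hR : R * R = 1) {k r N : ℕ} (hk : 1 ≤ k) (hr : k ≤ r)
    {c : Circuit} (hflip : Gate.vacuumFlip ∉ c) (hN : Circuit.sOneCount c ≤ N)
    (hc : (fun y : ℝ => Circuit.eval ρ R ((y : ℂ) • G) c - expPow L k 1 y)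
      =O[𝓝 0] fun y : ℝ => y ^ (r + 1)) :
    ∃ c' : Circuit, Gate.vacuumFlip ∉ c' ∧ Circuit.sOneCount c' ≤ (2 * k + 2) * N ∧
      (fun y : ℝ => Circuit.eval ρ R ((y : ℂ) • G) c' - expPow L k 1 y)
        =O[𝓝 0] fun y : ℝ => y ^ (r + k + 1) := by
  obtain ⟨e, he⟩ := exists_expansion ((Circuit.eval_analyticAt (R := R) ρ G c 0).sub
    (analyticAt_expPow L k 1 0)) (show r + 1 ≤ r + k + 1 by omega) hc
  -- The sum at k must be 1 to keep the exponent; the sums at the k error exponents must vanish.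
  -- That makes k + 1 conditions.
  obtain ⟨l, hl, hs⟩ := exists_pairs_power_sums (insert k (Finset.Ico (r + 1) (r + k + 1)))
    (by simp; omega) k (by simp)
  have hcard : l.length ≤ k + 1 := by
    refine hl.trans ((Finset.card_insert_le _ _).trans ?_)
    simp
  refine ⟨Circuit.ratios c l, Circuit.vacuumFlip_notMem_ratios hflip l, ?_, ?_⟩
  · rw [Circuit.sOneCount_ratios]
    exact Nat.mul_le_mul (by omega) hN
  · have h := Circuit.ratios_expApprox hR (by omega) (show r + k + 1 ≤ (r + 1) + k by omega)
      (by omega) e he l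
    rw [hs k (by simp), if_pos rfl] at h
    refine IsBigO.congr_left h fun y => ?_
    rw [sub_eq_self]
    refine Finset.sum_eq_zero fun j hj => ?_
    rw [hs j (Finset.mem_insert_of_mem hj), if_neg (by have := Finset.mem_Ico.1 hj; omega)]
    simp

end OrderRaising

/-- Circuits for `exp (y ^ k g_k)`, with `g_k` the generator of the `k`-th power, of arbitrarily
high order. -/
theorem exists_circuit_ladder {𝔸 : Type*} [NormedRing 𝔸] [NormedAlgebra ℂ 𝔸] [CompleteSpace 𝔸]
    {ρ : Matrix (Fin 2) (Fin 2) ℂ →ₐ[ℂ] 𝔸} {R b b' : 𝔸} (hR : R * R = 1)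
    (hb : ∀ M, Commute (ρ M) b) (hb' : ∀ M, Commute (ρ M) b') (n k S : ℕ) (hk : 1 ≤ k)
    (hkn : k ≤ 2 ^ n) :
    ∃ c : Circuit, Gate.vacuumFlip ∉ c ∧ Circuit.sOneCount c ≤ (2 * k + 2) ^ S * 12 ^ n ∧
      (fun y : ℝ => Circuit.eval ρ R ((y : ℂ) • (ρ lowerᴴ * b' + ρ lower * b)) c
        - expPow (ladder ρ b b' lower k) k 1 y) =O[𝓝 0] fun y : ℝ => y ^ (k * (S + 1) + 1) := by
  induction S with
  | zero =>
    obtain ⟨c, h1, h2, h3⟩ := hasCircuit_ladder hR hb hb' n k hk hkn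
    refine ⟨c, h1, by simpa using h2, ?_⟩
    have h4 := IsBigO.sub h3 (expPow_sub_isBigO (ladder ρ b b' lower k) (by omega : k ≠ 0) 1)
    rw [zero_add, mul_one]
    refine h4.congr_left fun y => ?_
    simp
  | succ S ih =>
    obtain ⟨c, h1, h2, h3⟩ := ih
    obtain ⟨c', h4, h5, h6⟩ := exists_circuit_order_add hR hk
      (Nat.le_mul_of_pos_right k (Nat.succ_pos S)) h1 h2 h3
    refine ⟨c', h4, h5.trans (le_of_eq (by ring)), ?_⟩
    exact h6

/-! ### The Trotter-Suzuki formula and its order -/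

/-- The Trotter-Suzuki recursion in a monoid. -/
noncomputable def trotterProd {M : Type*} [Monoid M] (V W : ℝ → M) : ℕ → ℝ → M
  | 0, _ => 1
  | 1, x => V (x / 2) * W (x / 2) * W (x / 2) * V (x / 2)
  | q + 2, x =>
      trotterProd V W (q + 1) (suzukiCoeff (q + 2) * x)
        * trotterProd V W (q + 1) (suzukiCoeff (q + 2) * x)
        * trotterProd V W (q + 1) ((1 - 4 * suzukiCoeff (q + 2)) * x)
        * trotterProd V W (q + 1) (suzukiCoeff (q + 2) * x)
        * trotterProd V W (q + 1) (suzukiCoeff (q + 2) * x)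

theorem map_trotterProd {M N : Type*} [Monoid M] [Monoid N] (φ : M →* N) (V W : ℝ → M) (q : ℕ)
    (x : ℝ) : φ (trotterProd V W q x) = trotterProd (fun x => φ (V x)) (fun x => φ (W x)) q x := by
  induction q using Nat.twoStepInduction generalizing x with
  | zero => simp [trotterProd]
  | one => simp [trotterProd]
  | more q _ ih => simp only [trotterProd, map_mul, ih]

theorem Circuit.op_trotter (Λ : ℕ) (U₁ U₂ : ℝ → Circuit) (q : ℕ) (x : ℝ) :
    Circuit.op Λ (trotter U₁ U₂ q x) =
      trotterProd (fun x => Circuit.op Λ (U₁ x)) (fun x => Circuit.op Λ (U₂ x)) q x := by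
  have happ (c d : Circuit) : Circuit.op Λ (c ++ d) = Circuit.op Λ c * Circuit.op Λ d := by
    simp [Circuit.op]
  induction q using Nat.twoStepInduction generalizing x with
  | zero => simp [trotterProd, trotter, Circuit.op]
  | one => simp only [trotterProd, trotter, happ]
  | more q _ ih => simp only [trotterProd, trotter, happ, ih]

theorem Circuit.sOneCount_trotter_le {U₁ U₂ : ℝ → Circuit} {N : ℕ}
    (h₁ : ∀ x, Circuit.sOneCount (U₁ x) ≤ N) (h₂ : ∀ x, Circuit.sOneCount (U₂ x) ≤ N) (q : ℕ)
    (x : ℝ) : Circuit.sOneCount (trotter U₁ U₂ (q + 1) x) ≤ 4 * 5 ^ q * N := by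
  induction q generalizing x with
  | zero =>
    simp only [trotter, sOneCount_append]
    have := h₁ (x / 2)
    have := h₂ (x / 2)
    omega
  | succ q ih =>
    simp only [trotter, sOneCount_append]
    have h1 := ih (suzukiCoeff (q + 2) * x)
    have h2 := ih ((1 - 4 * suzukiCoeff (q + 2)) * x)
    calc _ ≤ 5 * (4 * 5 ^ q * N) := by omega
      _ = _ := by ring

/-- The formula is a palindrome, so reversing the sign of x inverts the factors in the right order.
-/
theorem trotterProd_mul_neg {M : Type*} [Monoid M] {V W : ℝ → M} (hV : ∀ x, V x * V (-x) = 1)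
    (hW : ∀ x, W x * W (-x) = 1) (q : ℕ) (x : ℝ) :
    trotterProd V W q x * trotterProd V W q (-x) = 1 := by
  have key {a b c d : M} (h1 : a * c = 1) (h2 : b * d = 1) : (b * a) * (c * d) = 1 := by
    rw [mul_assoc, ← mul_assoc a, h1, one_mul, h2]
  induction q using Nat.twoStepInduction generalizing x with
  | zero => simp [trotterProd]
  | one =>
    simp only [trotterProd, neg_div]
    have h1 := key (key (key (hV (x / 2)) (hW (x / 2))) (hW (x / 2))) (hV (x / 2))
    simpa only [mul_assoc] using h1
  | more q _ ih =>
    simp only [trotterProd, mul_neg]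
    have hp := ih (suzukiCoeff (q + 2) * x)
    have hm := ih ((1 - 4 * suzukiCoeff (q + 2)) * x)
    have h1 := key (key (key (key hp hp) hm) hp) hp
    simpa only [mul_assoc] using h1

/-- With u = 4^(1/(2q+3)) the coefficient is s = 1/(4 - u), so 1 - 4s = -us. The odd power 2q + 3 of
-us is -4 s^(2q+3). -/
theorem suzukiCoeff_cancel (q : ℕ) :
    4 * suzukiCoeff (q + 2) ^ (2 * q + 3) + (1 - 4 * suzukiCoeff (q + 2)) ^ (2 * q + 3) = 0 := by
  have hr : (1 : ℝ) / (2 * ((q + 2 : ℕ) : ℝ) - 1) = ((2 * q + 3 : ℕ) : ℝ)⁻¹ := by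
    push_cast
    rw [one_div]
    congr 1; ring
  set u : ℝ := (4 : ℝ) ^ (((2 * q + 3 : ℕ) : ℝ)⁻¹) with hu
  have hur : u ^ (2 * q + 3) = 4 := Real.rpow_inv_natCast_pow (by norm_num) (by omega)
  have hu4 : u < 4 := by
    have h1 : (((2 * q + 3 : ℕ) : ℝ)⁻¹) < 1 := by
      apply inv_lt_one_of_one_lt₀
      exact_mod_cast (by omega : 1 < 2 * q + 3)
    exact (Real.rpow_lt_rpow_of_exponent_lt (by norm_num : (1 : ℝ) < 4) h1).trans_eq
      (Real.rpow_one 4)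
  have hs : suzukiCoeff (q + 2) = (4 - u)⁻¹ := by rw [suzukiCoeff, hr]
  have h1 : 1 - 4 * suzukiCoeff (q + 2) = -(u * suzukiCoeff (q + 2)) := by
    have h4 : 4 - u ≠ 0 := by linarith
    rw [hs]
    field_simp
    ring
  have hodd : Odd (2 * q + 3) := ⟨q + 1, by ring⟩
  rw [h1, hodd.neg_pow, mul_pow, hur]
  ring

section Order

variable {𝔸 : Type*} [NormedRing 𝔸] [NormedAlgebra ℂ 𝔸]

theorem HasLeadingTerm.eq_zero {A : 𝔸} {j : ℕ} (h : HasLeadingTerm (fun _ => (0 : 𝔸)) j A) :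
    A = 0 := by
  obtain ⟨C, hC⟩ := h.bound
  have h1 : ∀ᶠ y in 𝓝[>] (0 : ℝ), ‖A‖ ≤ C * y := by
    filter_upwards [nhdsWithin_le_nhds hC, self_mem_nhdsWithin] with y hy hy0
    have hy0 : 0 < y := hy0
    rw [zero_sub, norm_neg, norm_smul, norm_pow, Complex.norm_real, norm_pow,
      Real.norm_of_nonneg hy0.le, pow_succ] at hy
    have : y ^ j * ‖A‖ ≤ y ^ j * (C * y) := by linarith
    exact le_of_mul_le_mul_left this (pow_pos hy0 j)
  have h2 : Tendsto (fun y : ℝ => C * y) (𝓝[>] 0) (𝓝 0) := by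
    have : Continuous fun y : ℝ => C * y := by fun_prop
    simpa using (this.tendsto 0).mono_left nhdsWithin_le_nhds
  exact norm_le_zero_iff.1 (ge_of_tendsto h2 h1)

theorem HasLeadingTerm.mul_sub_one {f g : ℝ → 𝔸} {A B : 𝔸}
    (hf : HasLeadingTerm (fun y => f y - 1) 1 A) (hg : HasLeadingTerm (fun y => g y - 1) 1 B) :
    HasLeadingTerm (fun y => f y * g y - 1) 1 (A + B) := by
  have h := (hf.add hg).add (HasLeadingTerm.of_isBigO (j := 1)
    (isBigO_mul_pow hf.isBigO hg.isBigO (by omega)))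
  rw [add_zero] at h
  convert h using 2 with y
  noncomm_ring

variable [CompleteSpace 𝔸]

/-- If S = E + y^r e + ... with r even and E the exponential, then S(y) S(-y) = 1 = E(y) E(-y)
forces 2e = 0: a symmetric formula has no leading error of even order. -/
theorem isBigO_succ_of_symmetric {S : ℝ → 𝔸} {H : 𝔸} (hS : AnalyticAt ℝ S 0)
    (hsym : ∀ y, S y * S (-y) = 1) {r : ℕ} (hr : Even r) (hr0 : r ≠ 0)
    (h : (fun y => S y - expPow H 1 1 y) =O[𝓝 0] fun y : ℝ => y ^ r) :
    (fun y => S y - expPow H 1 1 y) =O[𝓝 0] fun y : ℝ => y ^ (r + 1) := by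
  obtain ⟨e, he⟩ := exists_hasLeadingTerm (hS.sub (analyticAt_expPow H 1 1 0)) h
  have hm := he.comp_mul (-1)
  simp only [neg_one_mul, Complex.ofReal_neg, Complex.ofReal_one, hr.neg_one_pow, one_smul] at hm
  have hE : HasLeadingTerm (expPow H 1 1) 0 1 := by
    have := expPow_sub_one_isBigO H one_ne_zero 1
    simpa [HasLeadingTerm] using this
  have hE' : HasLeadingTerm (fun y => expPow H 1 1 (-y)) 0 1 := by
    simpa using hE.comp_mul (-1)
  have h3 : HasLeadingTerm (fun y => (S y - expPow H 1 1 y) * (S (-y) - expPow H 1 1 (-y))) r 0 :=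
    HasLeadingTerm.of_isBigO (isBigO_mul_pow he.isBigO hm.isBigO (by omega))
  have h1 := he.mul hE'
  have h2 := hE.mul hm
  rw [zero_add] at h2
  have h4 := (h1.add h2).add h3
  have h5 : ∀ y, (S y - expPow H 1 1 y) * expPow H 1 1 (-y)
      + expPow H 1 1 y * (S (-y) - expPow H 1 1 (-y))
      + (S y - expPow H 1 1 y) * (S (-y) - expPow H 1 1 (-y)) = 0 := by
    intro y
    have h6 : expPow H 1 1 y * expPow H 1 1 (-y) = 1 := by
      have := expPow_comp_mul H 1 1 (-1) y
      rw [neg_one_mul] at this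
      rw [this, expPow_mul]
      simp
    calc _ = S y * S (-y) - expPow H 1 1 y * expPow H 1 1 (-y) := by noncomm_ring
      _ = 0 := by rw [hsym, h6, sub_self]
  simp only [Pi.sub_apply] at h4
  simp_rw [h5] at h4
  simp only [add_zero, mul_one, one_mul] at h4
  have h7 := h4.eq_zero
  rw [← two_nsmul, ← Nat.cast_smul_eq_nsmul ℂ] at h7
  have h8 : e = 0 := by simpa using h7
  rw [h8] at he
  simpa [HasLeadingTerm] using he

theorem trotterProd_analyticAt {V W : ℝ → 𝔸} (hV : ∀ x, AnalyticAt ℝ V x)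
    (hW : ∀ x, AnalyticAt ℝ W x) (q : ℕ) (x : ℝ) :
    AnalyticAt ℝ (trotterProd V W q) x := by
  induction q using Nat.twoStepInduction generalizing x with
  | zero => exact analyticAt_const
  | one =>
    have h2 : AnalyticAt ℝ (fun x : ℝ => x / 2) x := analyticAt_id.div_const
    have h3 : AnalyticAt ℝ (fun x => V (x / 2)) x := AnalyticAt.comp (g := V) (hV (x / 2)) h2
    have h4 : AnalyticAt ℝ (fun x => W (x / 2)) x := AnalyticAt.comp (g := W) (hW (x / 2)) h2
    exact ((h3.mul h4).mul h4).mul h3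
  | more q _ ih =>
    have h2 (b : ℝ) : AnalyticAt ℝ (fun x : ℝ => trotterProd V W (q + 1) (b * x)) x :=
      AnalyticAt.comp (g := trotterProd V W (q + 1)) (ih (b * x)) (analyticAt_const.mul analyticAt_id)
    exact ((((h2 _).mul (h2 _)).mul (h2 _)).mul (h2 _)).mul (h2 _)

/-- The order of the Trotter-Suzuki formula. -/
theorem trotterProd_sub_isBigO (A B : 𝔸) (q : ℕ) :
    (fun y => trotterProd (expPow A 1 1) (expPow B 1 1) (q + 1) y - expPow (A + B) 1 1 y)
      =O[𝓝 0] fun y : ℝ => y ^ (2 * q + 3) := by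
  have hinv (A : 𝔸) (y : ℝ) : expPow A 1 1 y * expPow A 1 1 (-y) = 1 := by
    have := expPow_comp_mul A 1 1 (-1) y
    rw [neg_one_mul] at this
    rw [this, expPow_mul]
    simp
  have hsym := trotterProd_mul_neg (hinv A) (hinv B)
  have han := trotterProd_analyticAt (analyticAt_expPow A 1 1) (analyticAt_expPow B 1 1)
  induction q with
  | zero =>
    -- Only first-order agreement needs checking; symmetry gives O(y^3).
    refine isBigO_succ_of_symmetric (han 1 0) (hsym 1) (r := 2) even_two two_ne_zero ?_
    have hhalf (A : 𝔸) : HasLeadingTerm (fun y => expPow A 1 1 (y / 2) - 1) 1 ((1 / 2 : ℂ) • A) := by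
      have h1 : HasLeadingTerm (fun y => expPow A 1 1 y - 1) 1 A := by
        simpa [HasLeadingTerm] using expPow_sub_isBigO A one_ne_zero 1
      simpa [div_eq_inv_mul] using h1.comp_mul (1 / 2)
    have h1 := (((hhalf A).mul_sub_one (hhalf B)).mul_sub_one (hhalf B)).mul_sub_one (hhalf A)
    have h2 : HasLeadingTerm (fun y => expPow (A + B) 1 1 y - 1) 1 (A + B) := by
      simpa [HasLeadingTerm] using expPow_sub_isBigO (A + B) one_ne_zero 1
    have h3 := h1.sub h2
    have h4 : (1 / 2 : ℂ) • A + (1 / 2 : ℂ) • B + (1 / 2 : ℂ) • B + (1 / 2 : ℂ) • A - (A + B) = 0 := by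
      module
    rw [h4] at h3
    refine (IsBigO.congr_left h3 fun y => ?_)
    simp [trotterProd]
  | succ q ih =>
    -- The Suzuki coefficients cancel the error at 2q + 3, and symmetry then cancels the one at 2q +
    -- 4.
    refine isBigO_succ_of_symmetric (han _ 0) (hsym _) (r := 2 * q + 4) ⟨q + 2, by ring⟩
      (by omega) ?_
    obtain ⟨e, he⟩ := exists_hasLeadingTerm ((han (q + 1) 0).sub
      (analyticAt_expPow (A + B) 1 1 0)) ih
    have hQ (c : ℝ) : (fun y : ℝ => (((c * y : ℝ) : ℂ) ^ (2 * q + 3)) • e)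
        =O[𝓝 0] fun y : ℝ => y ^ (2 * q + 3) :=
      isBigO_comp_mul (isBigO_pow_smul _ e) c
    have h1 : ExpApprox (A + B) 1 (2 * q + 4) 1 (fun y : ℝ => ((y : ℂ) ^ (2 * q + 3)) • e)
        (trotterProd (expPow A 1 1) (expPow B 1 1) (q + 1)) := he
    have hp := h1.comp_mul (suzukiCoeff (q + 2))
    have hz := h1.comp_mul (1 - 4 * suzukiCoeff (q + 2))
    have m1 : 2 * q + 4 ≤ 2 * q + 3 + 1 := by omega
    have m2 : 2 * q + 4 ≤ 2 * (2 * q + 3) := by omega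
    have b2 := (hQ (suzukiCoeff (q + 2))).add (hQ (suzukiCoeff (q + 2)))
    have b3 := b2.add (hQ (1 - 4 * suzukiCoeff (q + 2)))
    have b4 := b3.add (hQ (suzukiCoeff (q + 2)))
    have h5 := ((((hp.mul one_ne_zero m1 m2 (hQ _) (hQ _) hp).mul one_ne_zero m1 m2
      b2 (hQ _) hz).mul one_ne_zero m1 m2 b3 (hQ _) hp).mul one_ne_zero m1 m2 b4 (hQ _) hp)
    have hs : 1 * suzukiCoeff (q + 2) ^ 1 + 1 * suzukiCoeff (q + 2) ^ 1
        + 1 * (1 - 4 * suzukiCoeff (q + 2)) ^ 1 + 1 * suzukiCoeff (q + 2) ^ 1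
        + 1 * suzukiCoeff (q + 2) ^ 1 = 1 := by ring
    rw [hs] at h5
    refine IsBigO.congr_left h5 fun y => ?_
    have hc : (4 * (suzukiCoeff (q + 2) : ℂ) ^ (2 * q + 3)
        + (1 - 4 * (suzukiCoeff (q + 2) : ℂ)) ^ (2 * q + 3)) = 0 := by
      exact_mod_cast congrArg (fun x : ℝ => (x : ℂ)) (suzukiCoeff_cancel q)
    have hc' : ((suzukiCoeff (q + 2) * y : ℝ) : ℂ) ^ (2 * q + 3) • e
        + ((suzukiCoeff (q + 2) * y : ℝ) : ℂ) ^ (2 * q + 3) • e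
        + (((1 - 4 * suzukiCoeff (q + 2)) * y : ℝ) : ℂ) ^ (2 * q + 3) • e
        + ((suzukiCoeff (q + 2) * y : ℝ) : ℂ) ^ (2 * q + 3) • e
        + ((suzukiCoeff (q + 2) * y : ℝ) : ℂ) ^ (2 * q + 3) • e = 0 := by
      simp only [← add_smul]
      have : ((suzukiCoeff (q + 2) * y : ℝ) : ℂ) ^ (2 * q + 3)
        + ((suzukiCoeff (q + 2) * y : ℝ) : ℂ) ^ (2 * q + 3)
        + (((1 - 4 * suzukiCoeff (q + 2)) * y : ℝ) : ℂ) ^ (2 * q + 3)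
        + ((suzukiCoeff (q + 2) * y : ℝ) : ℂ) ^ (2 * q + 3)
        + ((suzukiCoeff (q + 2) * y : ℝ) : ℂ) ^ (2 * q + 3) = 0 := by
        push_cast
        simp only [mul_pow]
        linear_combination (y : ℂ) ^ (2 * q + 3) * hc
      rw [this, zero_smul]
    beta_reduce
    rw [hc', sub_zero]
    rfl

end Order

/-! ### Propagation of errors through products of contractions -/

theorem norm_mul_sub_mul_le {𝔸 : Type*} [NormedRing 𝔸] {a b a' b' : 𝔸} (ha : ‖a‖ ≤ 1)
    (hb' : ‖b'‖ ≤ 1) : ‖a * b - a' * b'‖ ≤ ‖a - a'‖ + ‖b - b'‖ := by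
  have h : a * b - a' * b' = (a - a') * b' + a * (b - b') := by noncomm_ring
  rw [h]
  refine (norm_add_le _ _).trans (add_le_add ?_ ?_)
  · exact (norm_mul_le _ _).trans (mul_le_of_le_one_right (norm_nonneg _) hb')
  · exact (norm_mul_le _ _).trans (mul_le_of_le_one_left (norm_nonneg _) ha)

theorem norm_mul_le_one {𝔸 : Type*} [NormedRing 𝔸] {a b : 𝔸} (ha : ‖a‖ ≤ 1)
    (hb : ‖b‖ ≤ 1) : ‖a * b‖ ≤ 1 :=
  (norm_mul_le _ _).trans (mul_le_one₀ ha (norm_nonneg _) hb)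

theorem norm_trotterProd_le_one {𝔸 : Type*} [NormedRing 𝔸] {V W : ℝ → 𝔸}
    (hV : ∀ x, ‖V x‖ ≤ 1) (hW : ∀ x, ‖W x‖ ≤ 1) (q : ℕ) (x : ℝ) :
    ‖trotterProd V W (q + 1) x‖ ≤ 1 := by
  induction q generalizing x with
  | zero => exact norm_mul_le_one (norm_mul_le_one (norm_mul_le_one (hV _) (hW _)) (hW _)) (hV _)
  | succ q ih =>
    exact norm_mul_le_one (norm_mul_le_one (norm_mul_le_one (norm_mul_le_one (ih _) (ih _))
      (ih _)) (ih _)) (ih _)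

/-- Errors of the factors propagate linearly through the Trotter-Suzuki formula. -/
theorem exists_trotterProd_error (p : ℝ) (q : ℕ) : ∃ K : ℝ, 0 ≤ K ∧
    ∀ {𝔸 : Type} [NormedRing 𝔸] {V W V' W' : ℝ → 𝔸} {C τ : ℝ},
      (∀ x, ‖V x‖ ≤ 1) → (∀ x, ‖W x‖ ≤ 1) → (∀ x, ‖V' x‖ ≤ 1) → (∀ x, ‖W' x‖ ≤ 1) →
      0 ≤ τ → (∀ x, ‖V x - V' x‖ ≤ C * (τ * |x|) ^ p) →
      (∀ x, ‖W x - W' x‖ ≤ C * (τ * |x|) ^ p) →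
      ∀ x, ‖trotterProd V W (q + 1) x - trotterProd V' W' (q + 1) x‖
        ≤ K * (C * (τ * |x|) ^ p) := by
  have hscale (b τ x : ℝ) (hτ : 0 ≤ τ) : (τ * |b * x|) ^ p = |b| ^ p * (τ * |x|) ^ p := by
    rw [abs_mul, mul_left_comm, Real.mul_rpow (abs_nonneg _) (by positivity)]
  induction q with
  | zero =>
    refine ⟨4 * |1 / 2| ^ p, by positivity, ?_⟩
    intro 𝔸 _ V W V' W' C τ hV hW hV' hW' hτ h1 h2 x
    have e1 := h1 (1 / 2 * x)
    have e2 := h2 (1 / 2 * x)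
    rw [hscale _ _ _ hτ] at e1 e2
    rw [one_div_mul_eq_div] at e1 e2
    simp only [trotterProd]
    calc _ ≤ ‖V (x / 2) - V' (x / 2)‖ + ‖W (x / 2) - W' (x / 2)‖ + ‖W (x / 2) - W' (x / 2)‖
          + ‖V (x / 2) - V' (x / 2)‖ := by
          refine (norm_mul_sub_mul_le (norm_mul_le_one (norm_mul_le_one (hV _) (hW _)) (hW _))
            (hV' _)).trans (add_le_add_left ?_ _)
          refine (norm_mul_sub_mul_le (norm_mul_le_one (hV _) (hW _))
            (hW' _)).trans (add_le_add_left ?_ _)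
          exact norm_mul_sub_mul_le (hV _) (hW' _)
      _ ≤ _ := by linarith
  | succ q ih =>
    obtain ⟨K, hK, ih⟩ := ih
    refine ⟨(4 * |suzukiCoeff (q + 2)| ^ p + |1 - 4 * suzukiCoeff (q + 2)| ^ p) * K,
      by positivity, ?_⟩
    intro 𝔸 _ V W V' W' C τ hV hW hV' hW' hτ h1 h2 x
    have e1 := ih hV hW hV' hW' hτ h1 h2 (suzukiCoeff (q + 2) * x)
    have e2 := ih hV hW hV' hW' hτ h1 h2 ((1 - 4 * suzukiCoeff (q + 2)) * x)
    rw [hscale _ _ _ hτ] at e1 e2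
    have n1 := norm_trotterProd_le_one hV hW q
    have n2 := norm_trotterProd_le_one hV' hW' q
    simp only [trotterProd]
    refine (norm_mul_sub_mul_le (norm_mul_le_one (norm_mul_le_one (norm_mul_le_one (n1 _) (n1 _))
      (n1 _)) (n1 _)) (n2 _)).trans ((add_le_add_left (norm_mul_sub_mul_le (norm_mul_le_one
      (norm_mul_le_one (n1 _) (n1 _)) (n1 _)) (n2 _)) _).trans ((add_le_add_left (add_le_add_left
      (norm_mul_sub_mul_le (norm_mul_le_one (n1 _) (n1 _)) (n2 _)) _) _).trans
      ((add_le_add_left (add_le_add_left (add_le_add_left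
      (norm_mul_sub_mul_le (n1 _) (n2 _)) _) _) _).trans ?_)))
    linarith

/-! ### Operators at a fixed cutoff -/

/-- Qubit operators acting on the qubit-oscillator space. -/
noncomputable def kronLeft (Λ : ℕ) : Matrix (Fin 2) (Fin 2) ℂ →⋆ₐ[ℂ] Op Λ where
  toFun M := M ⊗ₖ (1 : Matrix (Fin (Λ + 1)) (Fin (Λ + 1)) ℂ)
  map_one' := Matrix.one_kronecker_one
  map_mul' M N := by rw [← Matrix.mul_kronecker_mul, mul_one]
  map_zero' := Matrix.zero_kronecker _
  map_add' M N := Matrix.add_kronecker _ _ _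
  commutes' r := by
    simp only [Algebra.algebraMap_eq_smul_one, Matrix.smul_kronecker, Matrix.one_kronecker_one]
  map_star' M := by
    simp only [Matrix.star_eq_conjTranspose, Matrix.conjTranspose_kronecker,
      Matrix.conjTranspose_one]

/-- Oscillator operators acting on the qubit-oscillator space. -/
noncomputable def kronRight (Λ : ℕ) : Matrix (Fin (Λ + 1)) (Fin (Λ + 1)) ℂ →⋆ₐ[ℂ] Op Λ where
  toFun A := (1 : Matrix (Fin 2) (Fin 2) ℂ) ⊗ₖ A
  map_one' := Matrix.one_kronecker_one
  map_mul' M N := by rw [← Matrix.mul_kronecker_mul, mul_one]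
  map_zero' := Matrix.kronecker_zero _
  map_add' M N := Matrix.kronecker_add _ _ _
  commutes' r := by
    simp only [Algebra.algebraMap_eq_smul_one, Matrix.kronecker_smul, Matrix.one_kronecker_one]
  map_star' M := by
    simp only [Matrix.star_eq_conjTranspose, Matrix.conjTranspose_kronecker,
      Matrix.conjTranspose_one]

theorem kronLeft_mul_kronRight (Λ : ℕ) (M : Matrix (Fin 2) (Fin 2) ℂ)
    (A : Matrix (Fin (Λ + 1)) (Fin (Λ + 1)) ℂ) : kronLeft Λ M * kronRight Λ A = M ⊗ₖ A := by
  change M ⊗ₖ (1 : Matrix (Fin (Λ + 1)) (Fin (Λ + 1)) ℂ) * (1 : Matrix (Fin 2) (Fin 2) ℂ) ⊗ₖ A = _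
  rw [← Matrix.mul_kronecker_mul, mul_one, one_mul]

theorem kronLeft_commute_kronRight (Λ : ℕ) (M : Matrix (Fin 2) (Fin 2) ℂ)
    (A : Matrix (Fin (Λ + 1)) (Fin (Λ + 1)) ℂ) : Commute (kronLeft Λ M) (kronRight Λ A) := by
  change _ = _
  rw [kronLeft_mul_kronRight]
  change _ = (1 : Matrix (Fin 2) (Fin 2) ℂ) ⊗ₖ A * M ⊗ₖ (1 : Matrix (Fin (Λ + 1)) (Fin (Λ + 1)) ℂ)
  rw [← Matrix.mul_kronecker_mul, mul_one, one_mul]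

theorem blockEncode_eq {Λ : ℕ} (A : Matrix (Fin (Λ + 1)) (Fin (Λ + 1)) ℂ) :
    blockEncode A = kronLeft Λ lowerᴴ * kronRight Λ Aᴴ + kronLeft Λ lower * kronRight Λ A := by
  rw [kronLeft_mul_kronRight, kronLeft_mul_kronRight, blockEncode, lower]
  simp

theorem blockEncode_isHermitian {Λ : ℕ} (A : Matrix (Fin (Λ + 1)) (Fin (Λ + 1)) ℂ) :
    star (blockEncode A) = blockEncode A := by
  simp [blockEncode, Matrix.star_eq_conjTranspose, Matrix.conjTranspose_kronecker, add_comm]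

/-- a†a is diagonal with entries 0, ..., Λ, and ‖a‖² = ‖a†a‖. -/
theorem norm_annihilation_le (Λ : ℕ) : ‖annihilation Λ‖ ≤ Real.sqrt Λ := by
  have h : (annihilation Λ)ᴴ * annihilation Λ =
      Matrix.diagonal fun i : Fin (Λ + 1) => ((i : ℕ) : ℂ) := by
    ext i j
    rw [Matrix.mul_apply, Matrix.diagonal_apply]
    rcases Fin.eq_zero_or_eq_succ j with rfl | ⟨j', rfl⟩
    · split_ifs with h
      · subst h
        simp [annihilation]
      · simp [annihilation]
    · rw [Finset.sum_eq_single (Fin.castSucc j')]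
      · by_cases h : i = j'.succ
        · subst h
          simp only [annihilation, Matrix.conjTranspose_apply, Matrix.of_apply, Fin.val_succ,
            Fin.val_castSucc, if_true, RCLike.star_def, Complex.conj_ofReal]
          rw [← Complex.ofReal_mul, Real.mul_self_sqrt (by positivity)]
          push_cast; rfl
        · have : (i : ℕ) ≠ (j' : ℕ) + 1 := fun h' => h (Fin.ext (by simpa using h'))
          simp [annihilation, h, this]
      · intro l _ hl
        have : (j' : ℕ) ≠ (l : ℕ) := fun h' => hl (Fin.ext (by simp [h']))
        simp [annihilation, this]
      · simp
  have h2 : ‖annihilation Λ‖ * ‖annihilation Λ‖ ≤ Λ := by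
    rw [← Matrix.l2_opNorm_conjTranspose_mul_self, h, Matrix.l2_opNorm_diagonal,
      pi_norm_le_iff_of_nonneg (by positivity)]
    intro i
    simp only [Complex.norm_natCast]
    exact_mod_cast Nat.lt_succ_iff.1 i.2
  exact Real.le_sqrt_of_sq_le (by rw [sq]; exact h2)

/-- The phase flip of the oscillator vacuum. -/
noncomputable def vacuumReflection (Λ : ℕ) : Op Λ := kronRight Λ (1 - (2 : ℂ) • vacuum Λ)

theorem vacuum_mul_self (Λ : ℕ) : vacuum Λ * vacuum Λ = vacuum Λ := by
  simp [vacuum]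

theorem vacuumReflection_mul_self (Λ : ℕ) : vacuumReflection Λ * vacuumReflection Λ = 1 := by
  rw [vacuumReflection, ← map_mul]
  have : (1 - (2 : ℂ) • vacuum Λ) * (1 - (2 : ℂ) • vacuum Λ) = 1 := by
    simp only [mul_sub, sub_mul, one_mul, mul_one, smul_mul_smul_comm, vacuum_mul_self]
    module
  rw [this, map_one]

theorem star_vacuumReflection (Λ : ℕ) : star (vacuumReflection Λ) = vacuumReflection Λ := by
  rw [vacuumReflection, ← map_star]
  congr 1
  rw [Matrix.star_eq_conjTranspose, Matrix.conjTranspose_sub, Matrix.conjTranspose_smul]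
  simp [vacuum]

theorem vacuumReflection_mem_unitary (Λ : ℕ) : vacuumReflection Λ ∈ unitary (Op Λ) := by
  rw [Unitary.mem_iff, star_vacuumReflection, vacuumReflection_mul_self]
  simp

theorem Circuit.op_eq_eval (Λ : ℕ) (c : Circuit) : Circuit.op Λ c =
    Circuit.eval (kronLeft Λ).toAlgHom (vacuumReflection Λ) (blockEncode (annihilation Λ)) c := by
  have : Gate.op Λ = Gate.eval (kronLeft Λ).toAlgHom (vacuumReflection Λ)
      (blockEncode (annihilation Λ)) := by
    ext1 g
    cases g <;> rfl
  rw [Circuit.op, Circuit.eval, this]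

theorem exp_I_smul_mem_unitary {Λ : ℕ} (t : ℝ) {H : Op Λ} (hH : star H = H) :
    NormedSpace.exp ((Complex.I * (t : ℂ)) • H) ∈ unitary (Op Λ) := by
  let _ := NormedAlgebra.restrictScalars ℚ ℂ (Op Λ)
  apply NormedSpace.exp_mem_unitary_of_mem_skewAdjoint
  rw [skewAdjoint.mem_iff, star_smul, hH]
  simp

theorem Gate.op_mem_unitary (Λ : ℕ) (g : Gate) : Gate.op Λ g ∈ unitary (Op Λ) := by
  cases g with
  | sOne s => exact exp_I_smul_mem_unitary s (blockEncode_isHermitian _)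
  | qubit U => exact Unitary.map_mem (kronLeft Λ) U.2
  | vacuumFlip => exact vacuumReflection_mem_unitary Λ

theorem Circuit.op_mem_unitary (Λ : ℕ) (c : Circuit) : Circuit.op Λ c ∈ unitary (Op Λ) := by
  refine Submonoid.list_prod_mem _ fun x hx => ?_
  obtain ⟨g, -, rfl⟩ := List.mem_map.1 hx
  exact Gate.op_mem_unitary Λ g

theorem Circuit.norm_op (Λ : ℕ) (c : Circuit) : ‖Circuit.op Λ c‖ = 1 :=
  CStarRing.norm_of_mem_unitary (Circuit.op_mem_unitary Λ c)

theorem norm_idealT (Λ k : ℕ) (t : ℝ) : ‖idealT Λ k t‖ = 1 :=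
  CStarRing.norm_of_mem_unitary (exp_I_smul_mem_unitary t (blockEncode_isHermitian _))

theorem norm_idealP (Λ k : ℕ) (t : ℝ) : ‖idealP Λ k t‖ = 1 :=
  CStarRing.norm_of_mem_unitary (exp_I_smul_mem_unitary t (blockEncode_isHermitian _))

/-! ### One Banach algebra for all cutoffs -/

/-- Uniformly bounded families of operators, one for each cutoff. -/
noncomputable abbrev OpFamily : Type := lp (fun Λ : ℕ => Op Λ) ∞

namespace OpFamily

/-- A uniformly bounded family. -/
noncomputable def mk (f : ∀ Λ : ℕ, Op Λ) (C : ℝ) (h : ∀ Λ, ‖f Λ‖ ≤ C) : OpFamily :=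
  ⟨f, memℓp_infty ⟨C, by rintro _ ⟨Λ, rfl⟩; exact h Λ⟩⟩

/-- Evaluation of a family at a cutoff. -/
noncomputable def at_ (Λ : ℕ) : OpFamily →ₐ[ℂ] Op Λ where
  toFun f := f Λ
  map_one' := rfl
  map_mul' _ _ := rfl
  map_zero' := rfl
  map_add' _ _ := rfl
  commutes' _ := rfl

theorem norm_at_le (Λ : ℕ) (f : OpFamily) : ‖at_ Λ f‖ ≤ ‖f‖ :=
  lp.norm_apply_le_norm ENNReal.top_ne_zero f Λ

theorem continuous_at (Λ : ℕ) : Continuous (at_ Λ) :=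
  AddMonoidHomClass.continuous_of_bound (at_ Λ) 1 fun f => by
    rw [one_mul]; exact norm_at_le Λ f

@[ext] theorem ext_at {f g : OpFamily} (h : ∀ Λ, at_ Λ f = at_ Λ g) : f = g :=
  Subtype.ext (funext h)

theorem at_exp (Λ : ℕ) (f : OpFamily) :
    at_ Λ (NormedSpace.exp f) = NormedSpace.exp (at_ Λ f) := by
  let _ := NormedAlgebra.restrictScalars ℚ ℂ OpFamily
  let _ := NormedAlgebra.restrictScalars ℚ ℂ (Op Λ)
  exact NormedSpace.map_exp (at_ Λ) (continuous_at Λ) f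

/-- Qubit operators, for every cutoff. -/
noncomputable def qubit : Matrix (Fin 2) (Fin 2) ℂ →ₐ[ℂ] OpFamily where
  toFun M := mk (fun Λ => kronLeft Λ M) ‖M‖ fun Λ => NonUnitalStarAlgHom.norm_apply_le (kronLeft Λ) M
  map_one' := ext_at fun Λ => map_one (kronLeft Λ)
  map_mul' M N := ext_at fun Λ => map_mul (kronLeft Λ) M N
  map_zero' := ext_at fun Λ => map_zero (kronLeft Λ)
  map_add' M N := ext_at fun Λ => map_add (kronLeft Λ) M N
  commutes' r := ext_at fun Λ => (kronLeft Λ).commutes' r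

/-- The case Λ = 0 is included, since 0⁻¹ = 0; this lets the family range over all cutoffs. -/
theorem norm_scaled_annihilation_le (Λ : ℕ) :
    ‖((Real.sqrt Λ)⁻¹ : ℂ) • annihilation Λ‖ ≤ 1 := by
  rw [norm_smul, norm_inv, Complex.norm_real, Real.norm_of_nonneg (Real.sqrt_nonneg _)]
  exact (mul_le_mul_of_nonneg_left (norm_annihilation_le Λ) (by positivity)).trans
    (inv_mul_le_one (a := Real.sqrt Λ))

/-- The annihilation operators, scaled by `Λ ^ (-1/2)`. -/
noncomputable def annihilate : OpFamily :=
  mk (fun Λ => kronRight Λ (((Real.sqrt Λ)⁻¹ : ℂ) • annihilation Λ)) 1 fun Λ =>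
    (NonUnitalStarAlgHom.norm_apply_le (kronRight Λ) _).trans (norm_scaled_annihilation_le Λ)

/-- The creation operators, scaled by `Λ ^ (-1/2)`. -/
noncomputable def create : OpFamily :=
  mk (fun Λ => kronRight Λ (((Real.sqrt Λ)⁻¹ : ℂ) • annihilation Λ)ᴴ) 1 fun Λ =>
    (NonUnitalStarAlgHom.norm_apply_le (kronRight Λ) _).trans (by
      rw [Matrix.l2_opNorm_conjTranspose]; exact norm_scaled_annihilation_le Λ)

/-- The vacuum reflections. -/
noncomputable def reflection : OpFamily :=
  mk vacuumReflection 1 fun Λ =>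
    (CStarRing.norm_of_mem_unitary (vacuumReflection_mem_unitary Λ)).le

theorem reflection_mul_self : reflection * reflection = 1 :=
  ext_at fun Λ => vacuumReflection_mul_self Λ

theorem commute_qubit_annihilate (M : Matrix (Fin 2) (Fin 2) ℂ) :
    Commute (qubit M) annihilate :=
  ext_at fun Λ => kronLeft_commute_kronRight Λ M _

theorem commute_qubit_create (M : Matrix (Fin 2) (Fin 2) ℂ) : Commute (qubit M) create :=
  ext_at fun Λ => kronLeft_commute_kronRight Λ M _

/-- The generators of `T_k`, scaled by `Λ ^ (-k/2)`. -/
noncomputable def generator (k : ℕ) : OpFamily := ladder qubit annihilate create lower k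

/-- The power √Λ^k undoes the scaling, which is where Λ^(k/2) in the bounds originates. -/
theorem at_generator {Λ : ℕ} (hΛ : Λ ≠ 0) (k : ℕ) :
    ((Real.sqrt Λ : ℝ) : ℂ) ^ k • at_ Λ (generator k) =
      Complex.I • blockEncode (annihilation Λ ^ k) := by
  have hs : ((Real.sqrt Λ : ℝ) : ℂ) ≠ 0 := by
    rw [Complex.ofReal_ne_zero]; positivity
  have h1 : at_ Λ annihilate = (((Real.sqrt Λ : ℝ) : ℂ)⁻¹) • kronRight Λ (annihilation Λ) :=
    map_smul (kronRight Λ) _ _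
  have h2 : at_ Λ create = (((Real.sqrt Λ : ℝ) : ℂ)⁻¹) • kronRight Λ (annihilation Λ)ᴴ := by
    rw [← map_smul]
    change kronRight Λ _ = _
    rw [Matrix.conjTranspose_smul]
    simp
  have h3 (M : Matrix (Fin 2) (Fin 2) ℂ) : at_ Λ (qubit M) = kronLeft Λ M := rfl
  rw [generator, ladder, map_smul, map_add, map_mul, map_mul, map_pow, map_pow, h1, h2, h3, h3,
    blockEncode_eq, Matrix.conjTranspose_pow, map_pow, map_pow, smul_comm]
  congr 1
  rw [smul_pow, smul_pow, mul_smul_comm, mul_smul_comm, ← smul_add, smul_smul, ← mul_pow,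
    mul_inv_cancel₀ hs, one_pow, one_smul]

theorem at_eval (Λ : ℕ) (G : OpFamily) (c : Circuit) :
    at_ Λ (Circuit.eval qubit reflection G c) =
      Circuit.eval (kronLeft Λ).toAlgHom (vacuumReflection Λ) (at_ Λ G) c := by
  induction c with
  | nil => simp
  | cons g c ih =>
    rw [Circuit.eval_cons, Circuit.eval_cons, map_mul, ih]
    congr 1
    cases g with
    | sOne s => simp only [Gate.eval, at_exp, map_smul]
    | qubit U => rfl
    | vacuumFlip => rfl

theorem op_scale {Λ : ℕ} (hΛ : Λ ≠ 0) (c : Circuit) (x : ℝ) :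
    Circuit.op Λ (Circuit.scale x c) = at_ Λ (Circuit.eval qubit reflection
      (((Real.sqrt Λ * x : ℝ) : ℂ) • (qubit lowerᴴ * create + qubit lower * annihilate)) c) := by
  have h := at_generator hΛ 1
  rw [generator, ladder, map_smul, pow_one, pow_one, pow_one, smul_comm] at h
  have h2 := smul_right_injective _ Complex.I_ne_zero h
  beta_reduce at h2
  rw [at_eval, Circuit.op_eq_eval, Circuit.eval_scale, map_smul, Complex.ofReal_mul, mul_comm,
    mul_smul, h2, pow_one]

theorem at_expPow_generator {Λ : ℕ} (hΛ : Λ ≠ 0) (k j : ℕ) (x y : ℝ)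
    (h : y ^ j = Real.sqrt Λ ^ k * x) :
    at_ Λ (expPow (generator k) j 1 y) = idealT Λ k x := by
  rw [expPow, at_exp, idealT, map_smul, Complex.ofReal_one, one_mul, ← Complex.ofReal_pow, h,
    Complex.ofReal_mul, mul_comm, mul_smul, Complex.ofReal_pow, at_generator hΛ, smul_smul,
    mul_comm]

/-- An asymptotic bound for a family gives bounds uniform in the cutoff. -/
theorem exists_rpow_bound {f : ℝ → OpFamily} {m : ℕ} {s : ℝ} (hs : 0 ≤ s) (hsm : s ≤ m)
    (hf : f =O[𝓝 0] fun y : ℝ => y ^ m) :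
    ∃ C : ℝ, 0 < C ∧ ∀ (Λ : ℕ) (y : ℝ), ‖at_ Λ (f y)‖ ≤ 2 → ‖at_ Λ (f y)‖ ≤ C * |y| ^ s := by
  obtain ⟨C, hC0, hC⟩ := hf.exists_pos
  obtain ⟨ε, hε, hε'⟩ := Metric.eventually_nhds_iff.1 hC.bound
  -- The cap 1 gives |y|^m ≤ |y|^s near zero. Beyond δ, the bound 2 is absorbed by 2 (|y|/δ)^s.
  set δ := min ε 1
  have hδ : 0 < δ := lt_min hε one_pos
  refine ⟨C + 2 * (δ⁻¹) ^ s, by positivity, fun Λ y h2 => ?_⟩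
  have hy : 0 ≤ |y| ^ s := by positivity
  by_cases hyδ : |y| < δ
  · have h3 := hε' (y := y) (by rw [Real.dist_eq, sub_zero]; exact hyδ.trans_le (min_le_left _ _))
    rw [norm_pow, Real.norm_eq_abs] at h3
    have h4 : |y| ^ m ≤ |y| ^ s := by
      rcases eq_or_ne m 0 with rfl | hm
      · have : s = 0 := le_antisymm (by simpa using hsm) hs
        simp [this]
      rcases (abs_nonneg y).eq_or_lt with h0 | h0
      · rw [← h0, zero_pow hm]; positivity
      · rw [← Real.rpow_natCast]
        exact Real.rpow_le_rpow_of_exponent_ge h0 (hyδ.le.trans (min_le_right _ _)) hsm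
    calc ‖at_ Λ (f y)‖ ≤ C * |y| ^ m := (norm_at_le Λ _).trans h3
      _ ≤ C * |y| ^ s := by gcongr
      _ ≤ _ := by
        rw [add_mul]
        have : 0 ≤ 2 * δ⁻¹ ^ s * |y| ^ s := by positivity
        linarith
  · have h5 : 1 ≤ δ⁻¹ ^ s * |y| ^ s := by
      rw [← Real.mul_rpow (by positivity) (abs_nonneg _)]
      apply Real.one_le_rpow _ hs
      rw [inv_mul_eq_div, one_le_div hδ]
      exact not_lt.1 hyδ
    have : 0 ≤ C * |y| ^ s := by positivity
    calc ‖at_ Λ (f y)‖ ≤ 2 := h2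
      _ ≤ 2 * (δ⁻¹ ^ s * |y| ^ s) := by linarith
      _ ≤ _ := by rw [add_mul]; linarith

end OpFamily

/-! ### Implementing T_k within the stated cost -/

theorem sqrt_pow_eq_rpow (Λ k : ℕ) : Real.sqrt Λ ^ k = (Λ : ℝ) ^ ((k : ℝ) / 2) := by
  rw [Real.sqrt_eq_rpow, ← Real.rpow_natCast, ← Real.rpow_mul (Nat.cast_nonneg Λ)]
  congr 1; ring

/-- Since k < 2^n, 2k + 2 ≤ 4^n, and the exponents are at most np. Then 4 · 12 ≤ 30 · 20, and
20^(np) = 400^(np/2) is absorbed by the factor with base 420. -/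
theorem le_blockCost {k : ℕ} (hk : 1 ≤ k) {p : ℝ} (hp : 1 < p) :
    (((2 * k + 2) ^ (⌈p⌉₊ - 1) * 12 ^ Nat.size k : ℕ) : ℝ) ≤ blockCost (Nat.size k) p := by
  set n := Nat.size k with hn
  set S := ⌈p⌉₊ - 1 with hS
  have hn1 : 1 ≤ n := Nat.size_pos.2 hk
  have hk2 : k < 2 ^ n := Nat.lt_size_self k
  have hSp : (S : ℝ) ≤ p := by
    have h1 : (⌈p⌉₊ : ℝ) < p + 1 := Nat.ceil_lt_add_one (by linarith)
    have h2 : S + 1 = ⌈p⌉₊ := Nat.sub_add_cancel (Nat.one_le_ceil_iff.2 (by linarith))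
    have h3 : (S : ℝ) + 1 = ⌈p⌉₊ := by exact_mod_cast h2
    linarith
  have hn1' : (1 : ℝ) ≤ n := by exact_mod_cast hn1
  have hk4 : 2 * k + 2 ≤ 4 ^ n := by
    have h4 : (4 : ℕ) ^ n = 2 ^ n * 2 ^ n := by rw [← mul_pow]; norm_num
    have h2 : 2 ≤ 2 ^ n := by
      calc 2 = 2 ^ 1 := (pow_one 2).symm
        _ ≤ 2 ^ n := Nat.pow_le_pow_right (by norm_num) hn1
    rw [h4]
    nlinarith
  have h1 : (((2 * k + 2) ^ S * 12 ^ n : ℕ) : ℝ) ≤ ((4 : ℝ) ^ n) ^ S * 12 ^ n := by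
    exact_mod_cast Nat.mul_le_mul_right _ (Nat.pow_le_pow_left hk4 S)
  have h2 : ((4 : ℝ) ^ n) ^ S ≤ 4 ^ ((n : ℝ) * p) := by
    rw [← pow_mul, ← Real.rpow_natCast]
    apply Real.rpow_le_rpow_of_exponent_le (by norm_num)
    push_cast
    gcongr
  have h3 : (12 : ℝ) ^ n ≤ 12 ^ ((n : ℝ) * p) := by
    rw [← Real.rpow_natCast]
    apply Real.rpow_le_rpow_of_exponent_le (by norm_num)
    nlinarith
  have h4 : (4 : ℝ) ^ ((n : ℝ) * p) * 12 ^ ((n : ℝ) * p) ≤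
      30 ^ ((n : ℝ) * p) * 20 ^ ((n : ℝ) * p) := by
    rw [← Real.mul_rpow (by norm_num) (by norm_num), ← Real.mul_rpow (by norm_num) (by norm_num)]
    exact Real.rpow_le_rpow (by norm_num) (by norm_num) (by positivity)
  have h5 : (20 : ℝ) ^ ((n : ℝ) * p) ≤ 420 ^ ((n : ℝ) ^ 2 * p / 2) := by
    have h20 : (20 : ℝ) ^ ((n : ℝ) * p) = 400 ^ ((n : ℝ) * p / 2) := by
      rw [show (400 : ℝ) = 20 ^ (2 : ℝ) by norm_num, ← Real.rpow_mul (by norm_num)]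
      congr 1; ring
    rw [h20]
    refine (Real.rpow_le_rpow (by norm_num) (by norm_num : (400 : ℝ) ≤ 420) (by positivity)).trans
      (Real.rpow_le_rpow_of_exponent_le (by norm_num) ?_)
    have : (n : ℝ) * p ≤ (n : ℝ) ^ 2 * p := by
      gcongr
      nlinarith
    linarith
  have h6 : (1 : ℝ) ≤ (n : ℝ) ^ (1.6 : ℝ) := Real.one_le_rpow hn1' (by norm_num)
  have h7 : (1 : ℝ) ≤ (6 : ℝ) ^ (Real.logb 2 (n : ℝ) + 1) := by
    apply Real.one_le_rpow (by norm_num)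
    have := Real.logb_nonneg (b := 2) (by norm_num) hn1'
    linarith
  calc (((2 * k + 2) ^ S * 12 ^ n : ℕ) : ℝ) ≤ 4 ^ ((n : ℝ) * p) * 12 ^ ((n : ℝ) * p) :=
        h1.trans (by gcongr)
    _ ≤ 30 ^ ((n : ℝ) * p) * 420 ^ ((n : ℝ) ^ 2 * p / 2) := h4.trans (by gcongr)
    _ = 1 * (30 ^ ((n : ℝ) * p) * 420 ^ ((n : ℝ) ^ 2 * p / 2)) * 1 := by ring
    _ ≤ (n : ℝ) ^ (1.6 : ℝ) * (30 ^ ((n : ℝ) * p) * 420 ^ ((n : ℝ) ^ 2 * p / 2))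
        * (6 : ℝ) ^ (Real.logb 2 (n : ℝ) + 1) := by gcongr
    _ = _ := by rw [blockCost]; ring

theorem Circuit.op_inv_mul (Λ : ℕ) (c : Circuit) :
    Circuit.op Λ (Circuit.inv c) * Circuit.op Λ c = 1 := by
  rw [op_eq_eval, op_eq_eval]
  exact (Circuit.eval_inv_mul _ _ (vacuumReflection_mul_self Λ) c).1

theorem idealT_mul_neg (Λ k : ℕ) (t : ℝ) : idealT Λ k t * idealT Λ k (-t) = 1 := by
  let _ := NormedAlgebra.restrictScalars ℚ ℂ (Op Λ)
  rw [idealT, idealT, ← NormedSpace.exp_add_of_commute]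
  · simp
  · exact ((Commute.refl _).smul_left _).smul_right _

/-- Circuits of bounded size implementing `T_k` to order `p`. -/
theorem exists_orderImplementation {k : ℕ} (hk : 1 ≤ k) {p : ℝ} (hp : 1 < p) :
    ∃ T : ℝ → Circuit, IsOrderImplementation k p T ∧
      ∀ t, Circuit.sOneCount (T t) ≤ (2 * k + 2) ^ (⌈p⌉₊ - 1) * 12 ^ Nat.size k := by
  -- With ⌈p⌉ - 1 raising steps the error has order k⌈p⌉ + 1 in y, hence at least p in y^k.
  obtain ⟨c, hflip, hcount, hc⟩ := exists_circuit_ladder OpFamily.reflection_mul_self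
    OpFamily.commute_qubit_annihilate OpFamily.commute_qubit_create (Nat.size k) k (⌈p⌉₊ - 1) hk
    (Nat.lt_size_self k).le
  have hm : (k : ℝ) * p ≤ ((k * (⌈p⌉₊ - 1 + 1) + 1 : ℕ) : ℝ) := by
    rw [Nat.sub_add_cancel (Nat.one_le_ceil_iff.2 (by linarith))]
    push_cast
    have : (k : ℝ) * p ≤ k * ⌈p⌉₊ := by gcongr; exact Nat.le_ceil p
    linarith
  obtain ⟨C, hC0, hC⟩ := OpFamily.exists_rpow_bound (by positivity) hm hc
  have hpos (Λ : ℕ) (hΛ : k ≤ Λ) (t : ℝ) (ht : 0 ≤ t) :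
      ‖Circuit.op Λ (Circuit.scale (t ^ ((k : ℝ)⁻¹)) c) - idealT Λ k t‖
        ≤ C * ((Λ : ℝ) ^ ((k : ℝ) / 2) * |t|) ^ p := by
    have hΛ0 : Λ ≠ 0 := by omega
    have hx : (t ^ ((k : ℝ)⁻¹)) ^ k = t := Real.rpow_inv_natCast_pow ht (by omega)
    have h := hC Λ (Real.sqrt Λ * t ^ ((k : ℝ)⁻¹))
    rw [map_sub, ← OpFamily.op_scale hΛ0, ← OpFamily.generator,
      OpFamily.at_expPow_generator hΛ0 k k t _ (by rw [mul_pow, hx])] at h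
    have h2 := h ((norm_sub_le _ _).trans (by rw [Circuit.norm_op, norm_idealT]; norm_num))
    rw [Real.rpow_mul (abs_nonneg _), Real.rpow_natCast, ← abs_pow, mul_pow, hx,
      sqrt_pow_eq_rpow, abs_mul, abs_of_nonneg (by positivity : (0 : ℝ) ≤ (Λ : ℝ) ^ ((k : ℝ) / 2))]
      at h2
    exact h2
  -- A negative t has no real k-th root for even k, so the inverse circuit at -t is used; unitarity
  -- preserves the error.
  refine ⟨fun t => if 0 ≤ t then Circuit.scale (t ^ ((k : ℝ)⁻¹)) c
    else Circuit.inv (Circuit.scale ((-t) ^ ((k : ℝ)⁻¹)) c), ⟨?_, C, hC0, ?_⟩, ?_⟩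
  · intro t
    beta_reduce
    split_ifs
    · exact Circuit.vacuumFlip_notMem_scale hflip _
    · exact Circuit.vacuumFlip_notMem_inv (Circuit.vacuumFlip_notMem_scale hflip _)
  · intro Λ hΛ t
    beta_reduce
    split_ifs with ht
    · exact hpos Λ hΛ t ht
    · have h := hpos Λ hΛ (-t) (by linarith)
      set U := Circuit.op Λ (Circuit.scale ((-t) ^ ((k : ℝ)⁻¹)) c) with hU
      have e : Circuit.op Λ (Circuit.inv (Circuit.scale ((-t) ^ ((k : ℝ)⁻¹)) c)) - idealT Λ k t =
          Circuit.op Λ (Circuit.inv (Circuit.scale ((-t) ^ ((k : ℝ)⁻¹)) c))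
            * (-(U - idealT Λ k (-t))) * idealT Λ k t := by
        have h1 := Circuit.op_inv_mul Λ (Circuit.scale ((-t) ^ ((k : ℝ)⁻¹)) c)
        have h2 := idealT_mul_neg Λ k (-t)
        rw [neg_neg] at h2
        rw [neg_sub, mul_sub, sub_mul, h1, one_mul, mul_assoc, h2, mul_one]
      rw [e]
      refine (norm_mul_le _ _).trans ?_
      rw [norm_idealT, mul_one]
      refine (norm_mul_le _ _).trans ?_
      rw [Circuit.norm_op, one_mul, norm_neg]
      rwa [abs_neg] at h
  · intro t
    beta_reduce
    split_ifs
    · rwa [Circuit.sOneCount_scale]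
    · rwa [Circuit.sOneCount_inv, Circuit.sOneCount_scale]

/-! ### The vacuum reflection and the Fock preparation circuit -/

theorem annihilation_pow_apply (Λ k : ℕ) (i j : Fin (Λ + 1)) (h : (j : ℕ) ≠ (i : ℕ) + k) :
    (annihilation Λ ^ k) i j = 0 := by
  induction k generalizing j with
  | zero =>
    rw [pow_zero, Matrix.one_apply_ne]
    intro hij
    exact h (by simp [hij])
  | succ k ih =>
    rw [pow_succ, Matrix.mul_apply]
    refine Finset.sum_eq_zero fun l _ => ?_
    by_cases hl : (l : ℕ) = (i : ℕ) + k
    · have : (j : ℕ) ≠ (l : ℕ) + 1 := by omega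
      simp [annihilation, this]
    · rw [ih l hl, zero_mul]

theorem annihilation_pow_zero_apply (Λ k : ℕ) (hk : k ≤ Λ) :
    (annihilation Λ ^ k) 0 ⟨k, Nat.lt_succ_of_le hk⟩ =
      ((Real.sqrt (k.factorial : ℝ) : ℝ) : ℂ) := by
  induction k with
  | zero => simp
  | succ k ih =>
    rw [pow_succ, Matrix.mul_apply, Finset.sum_eq_single ⟨k, by omega⟩]
    · rw [ih (by omega), Nat.factorial_succ, mul_comm (k + 1), Nat.cast_mul,
        Real.sqrt_mul (by positivity), Complex.ofReal_mul]
      simp [annihilation]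
    · intro l _ hl
      rw [annihilation_pow_apply, zero_mul]
      intro h
      exact hl (Fin.ext (by simpa using h))
    · simp

theorem vacuum_mul_apply (Λ : ℕ) (A : Matrix (Fin (Λ + 1)) (Fin (Λ + 1)) ℂ) (i j : Fin (Λ + 1)) :
    (vacuum Λ * A) i j = if i = 0 then A 0 j else 0 := by
  split_ifs with h
  · subst h; simp [vacuum]
  · simp [vacuum, h]

theorem annihilation_pow_mul_vacuum (Λ : ℕ) {k : ℕ} (hk : 1 ≤ k) :
    annihilation Λ ^ k * vacuum Λ = 0 := by
  ext i j
  rw [Matrix.mul_apply]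
  refine Finset.sum_eq_zero fun l _ => ?_
  by_cases hl : l = 0
  · rw [annihilation_pow_apply Λ k i l (by rw [hl]; simp; omega), zero_mul]
  · rw [vacuum, Matrix.single_apply_of_row_ne (Ne.symm hl), mul_zero]

/-- Conjugation by the vacuum flip reverses the sign of the vacuum part of `a ^ k`. -/
theorem vacuumReflection_conj_blockEncode (Λ : ℕ) {k : ℕ} (hk : 1 ≤ k) :
    vacuumReflection Λ * blockEncode (annihilation Λ ^ k) * vacuumReflection Λ =
      blockEncode (annihilation Λ ^ k)
        - (2 : ℂ) • blockEncode (vacuum Λ * annihilation Λ ^ k) := by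
  set A := annihilation Λ ^ k
  -- This is where k ≥ 1 enters: the right reflection acts trivially on A, and the left one
  -- subtracts 2 |0⟩⟨0| A.
  have h0 : A * vacuum Λ = 0 := annihilation_pow_mul_vacuum Λ hk
  have hv : (vacuum Λ)ᴴ = vacuum Λ := by simp [vacuum]
  have h0' : vacuum Λ * Aᴴ = 0 := by
    have := congrArg Matrix.conjTranspose h0
    rwa [Matrix.conjTranspose_mul, hv, Matrix.conjTranspose_zero] at this
  have hA : (1 - (2 : ℂ) • vacuum Λ) * A * (1 - (2 : ℂ) • vacuum Λ) =
      A - (2 : ℂ) • (vacuum Λ * A) := by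
    simp only [mul_sub, sub_mul, mul_one, one_mul, smul_mul_assoc, mul_smul_comm, mul_assoc, h0]
    simp
  have hA' : (1 - (2 : ℂ) • vacuum Λ) * Aᴴ * (1 - (2 : ℂ) • vacuum Λ) =
      Aᴴ - (2 : ℂ) • (vacuum Λ * A)ᴴ := by
    rw [Matrix.conjTranspose_mul, hv]
    simp only [mul_sub, sub_mul, mul_one, one_mul, smul_mul_assoc, mul_smul_comm, h0']
    simp
  have hconj (M : Matrix (Fin 2) (Fin 2) ℂ) (B : Matrix (Fin (Λ + 1)) (Fin (Λ + 1)) ℂ) :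
      vacuumReflection Λ * (kronLeft Λ M * kronRight Λ B) * vacuumReflection Λ =
        kronLeft Λ M * kronRight Λ ((1 - (2 : ℂ) • vacuum Λ) * B * (1 - (2 : ℂ) • vacuum Λ)) := by
    rw [map_mul, map_mul, ← mul_assoc, vacuumReflection,
      ← (kronLeft_commute_kronRight Λ M (1 - (2 : ℂ) • vacuum Λ)).eq]
    simp only [mul_assoc]
  rw [blockEncode_eq, blockEncode_eq, mul_add, add_mul, hconj, hconj, hA, hA']
  simp only [map_sub, map_smul, mul_sub, mul_smul_comm, smul_add]
  abel

theorem trotterProd_comp_mul {M : Type*} [Monoid M] (V W : ℝ → M) (c : ℝ) (q : ℕ) (x : ℝ) :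
    trotterProd (fun x => V (c * x)) (fun x => W (c * x)) q x = trotterProd V W q (c * x) := by
  induction q using Nat.twoStepInduction generalizing x with
  | zero => rfl
  | one => simp only [trotterProd, mul_div_assoc]
  | more q _ ih => simp only [trotterProd, ih, mul_left_comm c]

namespace OpFamily

/-- The generator of `U₁` in the Fock preparation formula. -/
noncomputable def halfGenerator (k : ℕ) : OpFamily := (1 / 2 : ℂ) • generator k

/-- The generator of `U₂` in the Fock preparation formula. -/
noncomputable def reflectedGenerator (k : ℕ) : OpFamily :=
  (-(1 / 2) : ℂ) • (reflection * generator k * reflection)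

theorem at_expPow_halfGenerator {Λ : ℕ} (hΛ : Λ ≠ 0) (k : ℕ) (x : ℝ) :
    at_ Λ (expPow (halfGenerator k) 1 1 (Real.sqrt Λ ^ k * x)) = idealT Λ k (x / 2) := by
  rw [← at_expPow_generator hΛ k 1 (x / 2) (Real.sqrt Λ ^ k * (x / 2)) (pow_one _)]
  congr 1
  rw [expPow, expPow, halfGenerator, smul_smul]
  congr 2
  push_cast
  ring

theorem expPow_reflectedGenerator (k : ℕ) (y : ℝ) :
    expPow (reflectedGenerator k) 1 1 y =
      reflection * expPow (halfGenerator k) 1 1 (-y) * reflection := by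
  let _ := NormedAlgebra.restrictScalars ℚ ℂ OpFamily
  let u : OpFamilyˣ := ⟨reflection, reflection, reflection_mul_self, reflection_mul_self⟩
  have h := NormedSpace.exp_units_conj u
    (((((1 : ℝ) : ℂ) * (((-y : ℝ) : ℂ)) ^ 1)) • halfGenerator k)
  rw [expPow, expPow]
  refine Eq.trans ?_ h
  congr 1
  change _ = reflection * _ * reflection
  rw [reflectedGenerator, halfGenerator, mul_smul_comm, mul_smul_comm, smul_mul_assoc,
    smul_mul_assoc, smul_smul, smul_smul]
  congr 1
  push_cast
  ring

theorem at_expPow_reflectedGenerator {Λ : ℕ} (hΛ : Λ ≠ 0) (k : ℕ) (x : ℝ) :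
    at_ Λ (expPow (reflectedGenerator k) 1 1 (Real.sqrt Λ ^ k * x)) =
      vacuumReflection Λ * idealT Λ k (-(x / 2)) * vacuumReflection Λ := by
  rw [expPow_reflectedGenerator, map_mul, map_mul, ← mul_neg, at_expPow_halfGenerator hΛ, neg_div]
  rfl

theorem at_expPow_add {Λ : ℕ} (hΛ : Λ ≠ 0) {k : ℕ} (hk : 1 ≤ k) (x : ℝ) :
    at_ Λ (expPow (halfGenerator k + reflectedGenerator k) 1 1 (Real.sqrt Λ ^ k * x)) =
      idealP Λ k x := by
  have hR : at_ Λ reflection = vacuumReflection Λ := rfl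
  have e (z : ℂ) (X Y : Op Λ) : z • (X * Y * X) = X * (z • Y) * X := by
    rw [mul_smul_comm, smul_mul_assoc]
  have h : ((Real.sqrt Λ : ℝ) : ℂ) ^ k • at_ Λ (halfGenerator k + reflectedGenerator k) =
      Complex.I • blockEncode (vacuum Λ * annihilation Λ ^ k) := by
    rw [halfGenerator, reflectedGenerator, map_add, map_smul, map_smul, map_mul, map_mul, hR,
      smul_add, smul_comm, at_generator hΛ, smul_comm _ (-(1 / 2) : ℂ), e, at_generator hΛ,
      mul_smul_comm, smul_mul_assoc, vacuumReflection_conj_blockEncode Λ hk]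
    module
  rw [expPow, at_exp, idealP, map_smul, Complex.ofReal_one, one_mul, pow_one, Complex.ofReal_mul,
    mul_comm, mul_smul, Complex.ofReal_pow, h, smul_smul, mul_comm]

end OpFamily

theorem Circuit.op_append (Λ : ℕ) (c d : Circuit) :
    Circuit.op Λ (c ++ d) = Circuit.op Λ c * Circuit.op Λ d := by
  simp [Circuit.op]

theorem norm_reflection_conj_le (Λ : ℕ) (M : Op Λ) :
    ‖vacuumReflection Λ * M * vacuumReflection Λ‖ ≤ ‖M‖ := by
  have h := (CStarRing.norm_of_mem_unitary (vacuumReflection_mem_unitary Λ)).le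
  calc _ ≤ ‖vacuumReflection Λ‖ * ‖M‖ * ‖vacuumReflection Λ‖ :=
        (norm_mul_le _ _).trans (mul_le_mul_of_nonneg_right (norm_mul_le _ _) (norm_nonneg _))
    _ ≤ 1 * ‖M‖ * 1 := by gcongr
    _ = ‖M‖ := by ring

/-- For p > 1 the maximum with 1 is inactive. With index q + 1, the order 2q + 3 reaches p, while q
≤ (p - 1)/2 controls the count 5^q. -/
theorem trotterIndex_eq {p : ℝ} (hp : 1 < p) : ∃ q, trotterIndex p = q + 1 ∧
    p ≤ ((2 * q + 3 : ℕ) : ℝ) ∧ (q : ℝ) ≤ (p - 1) / 2 := by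
  have h1 : 1 ≤ ⌈(p - 1) / 2⌉₊ := Nat.one_le_ceil_iff.2 (by linarith)
  obtain ⟨q, hq⟩ := Nat.exists_eq_add_of_le' h1
  refine ⟨q, by rw [trotterIndex, max_eq_left h1, hq], ?_, ?_⟩
  · have := Nat.le_ceil ((p - 1) / 2)
    rw [hq] at this
    push_cast at this ⊢
    linarith
  · have := Nat.ceil_lt_add_one (a := (p - 1) / 2) (by linarith)
    rw [hq] at this
    push_cast at this
    linarith

/-- The Fock preparation circuit approximates the ideal Fock preparation to order `p`. -/
theorem exists_fockPrep_error {k : ℕ} (hk : 1 ≤ k) {p : ℝ} (hp : 1 < p) {T : ℝ → Circuit}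
    (hT : IsOrderImplementation k p T) :
    ∃ C : ℝ, 0 < C ∧ ∀ Λ : ℕ, k ≤ Λ → ∀ t : ℝ,
      ‖Circuit.op Λ (fockPrep T p t) - idealP Λ k t‖
        ≤ C * ((Λ : ℝ) ^ ((k : ℝ) / 2) * |t|) ^ p := by
  obtain ⟨-, C₀, hC₀, hT⟩ := hT
  obtain ⟨q, hq, hpq, -⟩ := trotterIndex_eq hp
  obtain ⟨K, hK, hprop⟩ := exists_trotterProd_error p q
  obtain ⟨C₁, hC₁, hlocal⟩ := OpFamily.exists_rpow_bound (by linarith : (0 : ℝ) ≤ p) hpq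
    (trotterProd_sub_isBigO (OpFamily.halfGenerator k) (OpFamily.reflectedGenerator k) q)
  -- K C₀ accounts for replacing T_k by its circuit in the formula, C₁ for the Trotter error of the
  -- exact exponentials.
  refine ⟨K * C₀ + C₁, by positivity, fun Λ hΛ t => ?_⟩
  have hΛ0 : Λ ≠ 0 := by omega
  have hτ : 0 ≤ (Λ : ℝ) ^ ((k : ℝ) / 2) := by positivity
  have hhalf (s x : ℝ) (hs : |s| = |x| / 2) :
      C₀ * ((Λ : ℝ) ^ ((k : ℝ) / 2) * |s|) ^ p ≤ C₀ * ((Λ : ℝ) ^ ((k : ℝ) / 2) * |x|) ^ p := by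
    rw [hs]
    gcongr
    linarith [abs_nonneg x]
  have hR (x : ℝ) : Circuit.op Λ ([Gate.vacuumFlip] ++ T (-(x / 2)) ++ [Gate.vacuumFlip]) =
      vacuumReflection Λ * Circuit.op Λ (T (-(x / 2))) * vacuumReflection Λ := by
    rw [Circuit.op_append, Circuit.op_append]
    have : Circuit.op Λ [Gate.vacuumFlip] = vacuumReflection Λ := by
      simp only [Circuit.op, List.map_cons, List.map_nil, List.prod_singleton]
      rfl
    rw [this]
  have hV' : ∀ x, ‖idealT Λ k (x / 2)‖ ≤ 1 := fun x => (norm_idealT _ _ _).le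
  have hW' : ∀ x, ‖vacuumReflection Λ * idealT Λ k (-(x / 2)) * vacuumReflection Λ‖ ≤ 1 :=
    fun x => (norm_reflection_conj_le _ _).trans (norm_idealT _ _ _).le
  have h1 := hprop (V := fun x => Circuit.op Λ (T (x / 2)))
    (W := fun x => Circuit.op Λ ([Gate.vacuumFlip] ++ T (-(x / 2)) ++ [Gate.vacuumFlip]))
    (V' := fun x => idealT Λ k (x / 2))
    (W' := fun x => vacuumReflection Λ * idealT Λ k (-(x / 2)) * vacuumReflection Λ)
    (C := C₀) (τ := (Λ : ℝ) ^ ((k : ℝ) / 2)) (fun x => (Circuit.norm_op _ _).le)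
    (fun x => (Circuit.norm_op _ _).le) hV' hW' hτ
    (fun x => (hT Λ hΛ (x / 2)).trans (hhalf _ _ (by rw [abs_div]; norm_num)))
    (fun x => by
      rw [hR, ← sub_mul, ← mul_sub]
      exact (norm_reflection_conj_le _ _).trans ((hT Λ hΛ (-(x / 2))).trans
        (hhalf _ _ (by rw [abs_neg, abs_div]; norm_num)))) t
  have hideal : trotterProd (fun x => idealT Λ k (x / 2))
      (fun x => vacuumReflection Λ * idealT Λ k (-(x / 2)) * vacuumReflection Λ) (q + 1) t =
      OpFamily.at_ Λ (trotterProd (expPow (OpFamily.halfGenerator k) 1 1)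
        (expPow (OpFamily.reflectedGenerator k) 1 1) (q + 1) (Real.sqrt Λ ^ k * t)) := by
    have := map_trotterProd ((OpFamily.at_ Λ : OpFamily →* Op Λ))
      (fun x => expPow (OpFamily.halfGenerator k) 1 1 (Real.sqrt Λ ^ k * x))
      (fun x => expPow (OpFamily.reflectedGenerator k) 1 1 (Real.sqrt Λ ^ k * x)) (q + 1) t
    rw [trotterProd_comp_mul] at this
    refine Eq.trans ?_ this.symm
    congr 1
    · ext1 x; exact (OpFamily.at_expPow_halfGenerator hΛ0 k x).symm
    · ext1 x; exact (OpFamily.at_expPow_reflectedGenerator hΛ0 k x).symm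
  have h2 := hlocal Λ (Real.sqrt Λ ^ k * t)
  rw [map_sub, OpFamily.at_expPow_add hΛ0 hk, ← hideal] at h2
  have h3 := h2 ((norm_sub_le _ _).trans (by
    rw [norm_idealP]
    have := norm_trotterProd_le_one hV' hW' q t
    linarith))
  rw [sqrt_pow_eq_rpow, abs_mul, abs_of_nonneg hτ] at h3
  rw [fockPrep, hq, Circuit.op_trotter]
  refine (norm_sub_le_norm_sub_add_norm_sub _ _ _).trans ((add_le_add h1 h3).trans
    (le_of_eq (by ring)))

/-! ### The ideal rotation of |1,0⟩ into |0,k⟩ -/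

theorem exp_mulVec_of_eigenvector {Λ : ℕ} {M : Op Λ} {w : Idx Λ → ℂ} {μ : ℂ}
    (h : M *ᵥ w = μ • w) : NormedSpace.exp M *ᵥ w = Complex.exp μ • w := by
  have hpow (n : ℕ) : M ^ n *ᵥ w = μ ^ n • w := by
    induction n with
    | zero => simp
    | succ n ih => rw [pow_succ, ← Matrix.mulVec_mulVec, h, Matrix.mulVec_smul, ih, smul_smul,
        pow_succ']
  let φ : Op Λ →ₗ[ℂ] (Idx Λ → ℂ) :=
    { toFun := fun M => M *ᵥ w
      map_add' := fun A B => Matrix.add_mulVec A B w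
      map_smul' := fun c A => Matrix.smul_mulVec c A w }
  have h1 : HasSum (fun n : ℕ => ((n.factorial : ℂ)⁻¹) • M ^ n) (NormedSpace.exp M) :=
    NormedSpace.exp_series_hasSum_exp' (𝕂 := ℂ) M
  have h2 := h1.map φ (LinearMap.continuous_of_finiteDimensional φ)
  have h3 : HasSum (fun n : ℕ => ((n.factorial : ℂ)⁻¹) • μ ^ n) (Complex.exp μ) := by
    rw [Complex.exp_eq_exp_ℂ]
    exact NormedSpace.exp_series_hasSum_exp' (𝕂 := ℂ) μ
  have h4 := h3.smul_const w
  refine h2.unique ?_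
  convert h4 using 1
  ext1 n
  change ((n.factorial : ℂ)⁻¹ • M ^ n) *ᵥ w = _
  rw [Matrix.smul_mulVec, hpow, smul_eq_mul, mul_smul]

theorem inner_ket_mulVec {Λ : ℕ} (M : Op Λ) (q q' : Fin 2) (m m' : Fin (Λ + 1)) :
    star (ket q m) ⬝ᵥ (M *ᵥ ket q' m') = M (q, m) (q', m') := by
  have : star (ket q m) = Pi.single (q, m) (1 : ℂ) := by
    rw [ket, ← Pi.single_star, star_one]
  rw [this, single_one_dotProduct, ket, Matrix.mulVec_single_one]
  rfl

theorem norm_entry_le {Λ : ℕ} (M : Op Λ) (i j : Idx Λ) : ‖M i j‖ ≤ ‖M‖ := by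
  have h := Matrix.l2_opNorm_mulVec M (EuclideanSpace.single j (1 : ℂ))
  rw [PiLp.norm_single, norm_one, mul_one] at h
  refine le_trans ?_ h
  have h2 := PiLp.norm_apply_le ((EuclideanSpace.equiv (Idx Λ) ℂ).symm
    (M *ᵥ (EuclideanSpace.single j (1 : ℂ)).ofLp)) i
  refine le_trans (le_of_eq ?_) h2
  simp

/-- The ideal Fock preparation rotates `|1,0⟩` into `|0,k⟩` at the rate `√k!`. -/
theorem idealP_entry {Λ k : ℕ} (hkΛ : k ≤ Λ) (t : ℝ) :
    idealP Λ k t (0, ⟨k, Nat.lt_succ_of_le hkΛ⟩) (1, 0) =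
      Complex.I * Complex.sin ((Real.sqrt (k.factorial : ℝ) * t : ℝ) : ℂ) := by
  set kk : Fin (Λ + 1) := ⟨k, Nat.lt_succ_of_le hkΛ⟩ with hkk
  set s : ℂ := ((Real.sqrt (k.factorial : ℝ) : ℝ) : ℂ) with hs
  set B := vacuum Λ * annihilation Λ ^ k with hB
  have hBentry (i j : Fin (Λ + 1)) : B i j = if i = 0 ∧ j = kk then s else 0 := by
    rw [hB, vacuum_mul_apply]
    by_cases hi : i = 0
    · by_cases hj : j = kk
      · rw [if_pos hi, if_pos ⟨hi, hj⟩, hj, hkk, annihilation_pow_zero_apply Λ k hkΛ]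
      · rw [if_pos hi, if_neg (fun h => hj h.2), annihilation_pow_apply]
        intro h
        exact hj (Fin.ext (by simpa [hkk] using h))
    · rw [if_neg hi, if_neg (fun h => hi h.1)]
  have hstar : star s = s := by simp [hs]
  have hentry (a b : Fin 2) (i j : Fin (Λ + 1)) : blockEncode B (a, i) (b, j) =
      (if a = 0 ∧ b = 1 then star (B j i) else 0) + if a = 1 ∧ b = 0 then B i j else 0 := by
    simp only [blockEncode, Matrix.add_apply, Matrix.kronecker_apply, Matrix.single_apply,
      Matrix.conjTranspose_apply, ite_mul, one_mul, zero_mul, eq_comm]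
  have hG1 : blockEncode B *ᵥ ket 1 0 = s • ket 0 kk := by
    ext ⟨a, i⟩
    rw [ket, Matrix.mulVec_single_one, Matrix.col_apply, hentry]
    fin_cases a
    · by_cases h : i = kk <;> simp [hBentry, ket, h, hstar]
    · simp [ket]
  have hG2 : blockEncode B *ᵥ ket 0 kk = s • ket 1 0 := by
    ext ⟨a, i⟩
    rw [ket, Matrix.mulVec_single_one, Matrix.col_apply, hentry]
    fin_cases a <;> simp [hBentry, ket, Pi.single_apply]
  -- The generator swaps |0,k⟩ and |1,0⟩ up to the factor √k!, so their sum and difference are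
  -- eigenvectors.
  have hplus : ((Complex.I * (t : ℂ)) • blockEncode B) *ᵥ (ket 0 kk + ket 1 0) =
      (Complex.I * t * s) • (ket 0 kk + ket 1 0) := by
    rw [Matrix.smul_mulVec, Matrix.mulVec_add, hG1, hG2]
    module
  have hminus : ((Complex.I * (t : ℂ)) • blockEncode B) *ᵥ (ket 0 kk - ket 1 0) =
      (-(Complex.I * t * s)) • (ket 0 kk - ket 1 0) := by
    rw [Matrix.smul_mulVec, Matrix.mulVec_sub, hG1, hG2]
    module
  have hv : ket (1 : Fin 2) (0 : Fin (Λ + 1)) =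
      (1 / 2 : ℂ) • (ket 0 kk + ket 1 0) - (1 / 2 : ℂ) • (ket 0 kk - ket 1 0) := by
    module
  rw [← inner_ket_mulVec (idealP Λ k t), hv, idealP, Matrix.mulVec_sub, Matrix.mulVec_smul, Matrix.mulVec_smul,
    exp_mulVec_of_eigenvector hplus, exp_mulVec_of_eigenvector hminus]
  have hne : ket (1 : Fin 2) (0 : Fin (Λ + 1)) (0, kk) = 0 := by simp [ket]
  have heq : ket (0 : Fin 2) kk (0, kk) = 1 := by simp [ket]
  have hstar' : star (ket (0 : Fin 2) kk) = Pi.single (0, kk) (1 : ℂ) := by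
    rw [ket, ← Pi.single_star, star_one]
  rw [hstar', single_one_dotProduct]
  simp only [Pi.sub_apply, Pi.smul_apply, Pi.add_apply, hne, heq, smul_eq_mul]
  rw [Complex.sin]
  have e1 : -((Real.sqrt (k.factorial : ℝ) * t : ℝ) : ℂ) * Complex.I = -(Complex.I * t * s) := by
    rw [hs]; push_cast; ring
  have e2 : ((Real.sqrt (k.factorial : ℝ) * t : ℝ) : ℂ) * Complex.I = Complex.I * t * s := by
    rw [hs]; push_cast; ring
  rw [e1, e2]
  linear_combination (-(Complex.exp (-(Complex.I * t * s)) - Complex.exp (Complex.I * t * s)) / 2)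
    * Complex.I_sq

/-! ### Time slicing and gate counts -/

theorem norm_pow_sub_pow_le {𝔸 : Type*} [NormedRing 𝔸] [NormOneClass 𝔸] {a b : 𝔸}
    (ha : ‖a‖ ≤ 1) (hb : ‖b‖ ≤ 1) (r : ℕ) : ‖a ^ r - b ^ r‖ ≤ r * ‖a - b‖ := by
  induction r with
  | zero => simp
  | succ r ih =>
    rw [pow_succ, pow_succ]
    refine (norm_mul_sub_mul_le ?_ hb).trans ?_
    · exact (norm_pow_le _ _).trans (pow_le_one₀ (norm_nonneg _) ha)
    · push_cast
      linarith

theorem Circuit.op_repeated (Λ : ℕ) (c : Circuit) (r : ℕ) :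
    Circuit.op Λ (Circuit.repeated c r) = Circuit.op Λ c ^ r := by
  induction r with
  | zero => simp [Circuit.repeated, Circuit.op]
  | succ r ih =>
    have : Circuit.repeated c (r + 1) = c ++ Circuit.repeated c r := by
      simp [Circuit.repeated, List.replicate_succ]
    rw [this, Circuit.op_append, ih, pow_succ']

theorem Circuit.sOneCount_repeated (c : Circuit) (r : ℕ) :
    Circuit.sOneCount (Circuit.repeated c r) = r * Circuit.sOneCount c := by
  induction r with
  | zero => simp [Circuit.repeated, Circuit.sOneCount]
  | succ r ih =>
    have : Circuit.repeated c (r + 1) = c ++ Circuit.repeated c r := by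
      simp [Circuit.repeated, List.replicate_succ]
    rw [this, Circuit.sOneCount_append, ih]
    ring

theorem idealP_pow (Λ k r : ℕ) (t : ℝ) : idealP Λ k t ^ r = idealP Λ k (r * t) := by
  let _ := NormedAlgebra.restrictScalars ℚ ℂ (Op Λ)
  rw [idealP, idealP, ← NormedSpace.exp_nsmul, ← Nat.cast_smul_eq_nsmul ℂ, smul_smul]
  congr 2
  push_cast
  ring

/-- The count is 4 · 5^q N with q ≤ (p - 1)/2, and 4/√5 ≤ 2. -/
theorem Circuit.sOneCount_fockPrep_le {p : ℝ} (hp : 1 < p) {T : ℝ → Circuit} {N : ℕ}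
    (hT : ∀ t, Circuit.sOneCount (T t) ≤ N) (t : ℝ) :
    (Circuit.sOneCount (fockPrep T p t) : ℝ) ≤ 2 * (5 : ℝ) ^ (p / 2) * N := by
  obtain ⟨q, hq, -, hqp⟩ := trotterIndex_eq hp
  have h1 : Circuit.sOneCount (fockPrep T p t) ≤ 4 * 5 ^ q * N := by
    rw [fockPrep, hq]
    refine Circuit.sOneCount_trotter_le (fun x => hT _) (fun x => ?_) q t
    rw [Circuit.sOneCount_append, Circuit.sOneCount_append]
    simpa [Circuit.sOneCount, Gate.sOneCost] using hT (-(x / 2))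
  have h2 : (4 : ℝ) * 5 ^ q ≤ 2 * (5 : ℝ) ^ (p / 2) := by
    have h3 : (5 : ℝ) ^ q * 5 ^ (1 / 2 : ℝ) ≤ (5 : ℝ) ^ (p / 2) := by
      rw [← Real.rpow_natCast, ← Real.rpow_add (by norm_num)]
      apply Real.rpow_le_rpow_of_exponent_le (by norm_num)
      linarith
    have h4 : (2 : ℝ) ≤ 5 ^ (1 / 2 : ℝ) := by
      rw [← Real.sqrt_eq_rpow]
      exact Real.le_sqrt_of_sq_le (by norm_num)
    have h5 : (5 : ℝ) ^ q * 2 ≤ 5 ^ q * 5 ^ (1 / 2 : ℝ) := by gcongr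
    linarith
  calc (Circuit.sOneCount (fockPrep T p t) : ℝ) ≤ ((4 * 5 ^ q * N : ℕ) : ℝ) := by exact_mod_cast h1
    _ = 4 * 5 ^ q * N := by push_cast; ring
    _ ≤ _ := by gcongr

theorem norm_idealP_entry_eq_one {Λ k : ℕ} (hkΛ : k ≤ Λ) (j : ℕ) :
    ‖idealP Λ k ((2 * (j : ℝ) + 1) * Real.pi / (2 * Real.sqrt (k.factorial : ℝ)))
      (0, ⟨k, Nat.lt_succ_of_le hkΛ⟩) (1, 0)‖ = 1 := by
  rw [idealP_entry hkΛ]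
  have hs : Real.sqrt (k.factorial : ℝ) ≠ 0 := by positivity
  have h1 : Real.sqrt (k.factorial : ℝ) *
      ((2 * (j : ℝ) + 1) * Real.pi / (2 * Real.sqrt (k.factorial : ℝ))) =
      Real.pi / 2 + j * Real.pi := by
    field_simp
    ring
  rw [h1, ← Complex.ofReal_sin, Real.sin_add_nat_mul_pi]
  simp

/-- The amplitude has modulus at least 1 - δ/2, and (1 - δ/2)² ≥ 1 - δ. -/
theorem one_sub_le_successProb {Λ k : ℕ} (hkΛ : k ≤ Λ) {M P : Op Λ} {δ : ℝ} (hδ : 0 ≤ δ)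
    (hδ1 : δ ≤ 1) (hMP : ‖M - P‖ ≤ δ / 2)
    (hP : ‖P (0, ⟨k, Nat.lt_succ_of_le hkΛ⟩) (1, 0)‖ = 1) : 1 - δ ≤ successProb hkΛ M := by
  rw [successProb, inner_ket_mulVec]
  have h1 := (norm_entry_le (M - P) (0, ⟨k, Nat.lt_succ_of_le hkΛ⟩) (1, 0)).trans hMP
  rw [Matrix.sub_apply] at h1
  have h2 := norm_sub_norm_le (P (0, ⟨k, Nat.lt_succ_of_le hkΛ⟩) (1, 0))
    (M (0, ⟨k, Nat.lt_succ_of_le hkΛ⟩) (1, 0))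
  rw [norm_sub_rev, hP] at h2
  have h3 : 1 - δ / 2 ≤ ‖M (0, ⟨k, Nat.lt_succ_of_le hkΛ⟩) (1, 0)‖ := by linarith
  nlinarith

/-- With `r` proportional to the slice scale, the accumulated error is at most `δ / 2`. -/
theorem slice_error_le {C τ p δ r : ℝ} (hC : 0 < C) (hτ : 0 < τ) (hp : 1 < p) (hδ : 0 < δ)
    (hr : 0 < r)
    (h : C ^ (1 / (p - 1)) * (τ ^ (1 + 1 / (p - 1)) / (δ / 2) ^ (1 / (p - 1))) ≤ r) :
    r * (C * (τ / r) ^ p) ≤ δ / 2 := by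
  have hp1 : 0 < p - 1 := by linarith
  -- The accumulated error is C τ^p / r^(p-1), so the hypothesis on r is raised to the power p - 1.
  have h1 := Real.rpow_le_rpow (by positivity) h hp1.le
  have hc : (1 / (p - 1)) * (p - 1) = 1 := by field_simp
  have hc2 : (1 + 1 / (p - 1)) * (p - 1) = p := by field_simp; ring
  rw [Real.mul_rpow (by positivity) (by positivity), Real.div_rpow (by positivity) (by positivity),
    ← Real.rpow_mul hC.le, ← Real.rpow_mul hτ.le, ← Real.rpow_mul (by positivity), hc, hc2,
    Real.rpow_one, Real.rpow_one, ← mul_div_assoc, div_le_iff₀ (by positivity)] at h1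
  have h2 : r ^ p = r ^ (p - 1) * r := by
    rw [← Real.rpow_add_one hr.ne']; congr 1; ring
  have h3 : r * (C * (τ / r) ^ p) = C * τ ^ p / r ^ (p - 1) := by
    rw [Real.div_rpow hτ.le hr.le, h2]
    field_simp
  rw [h3, div_le_iff₀ (by positivity)]
  linarith

end HybridOscillator

/-! ### Assembling the theorem -/

open HybridOscillator
theorem mainTheorem9 (k : ℕ) (hk : 1 ≤ k) (p : ℝ) (hp : 1 < p) :
    ∃ T : ℝ → Circuit, IsOrderImplementation k p T ∧
      (∀ t : ℝ, (Circuit.sOneCount (T t) : ℝ) ≤ blockCost (Nat.size k) p) ∧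
      (∃ C : ℝ, 0 < C ∧ ∀ Λ : ℕ, k ≤ Λ → ∀ t : ℝ,
        ‖Circuit.op Λ (fockPrep T p t) - idealP Λ k t‖
          ≤ C * ((Λ : ℝ) ^ ((k : ℝ) / 2) * |t|) ^ p) ∧
      ∃ c₁ c₂ : ℝ, 0 < c₁ ∧ 0 < c₂ ∧
        ∀ (Λ : ℕ) (hkΛ : k ≤ Λ) (j : ℕ) (t : ℝ),
          t = (2 * (j : ℝ) + 1) * Real.pi / (2 * Real.sqrt (k.factorial : ℝ)) →
          ∀ δ : ℝ, 0 < δ → δ ≤ 1 →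
            ∃ r : ℕ, c₁ * sliceScale Λ k p t δ ≤ (r : ℝ) ∧
              (r : ℝ) ≤ c₂ * sliceScale Λ k p t δ ∧
              1 - δ ≤ successProb hkΛ
                (Circuit.op Λ (Circuit.repeated (fockPrep T p (t / (r : ℝ))) r)) ∧
              (Circuit.sOneCount (Circuit.repeated (fockPrep T p (t / (r : ℝ))) r) : ℝ)
                ≤ (r : ℝ) * (2 * (5 : ℝ) ^ (p / 2) * blockCost (Nat.size k) p) := by
  obtain ⟨T, hT, hN⟩ := exists_orderImplementation hk hp
  have hcost := le_blockCost hk hp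
  obtain ⟨C, hC, hF⟩ := exists_fockPrep_error hk hp hT
  refine ⟨T, hT, fun t => (Nat.cast_le.2 (hN t)).trans hcost, ⟨C, hC, hF⟩, ?_⟩
  have hp1 : 0 < p - 1 := by linarith
  have hfact : 0 < Real.sqrt (k.factorial : ℝ) := by positivity
  set t₀ : ℝ := Real.pi / (2 * Real.sqrt (k.factorial : ℝ)) with ht₀
  have ht₀pos : 0 < t₀ := by positivity
  -- The extra term in c₂ absorbs the rounding up of r: t ≥ t₀, Λ ≥ 1 and δ/2 ≤ 1 keep the slice
  -- scale above t₀^(1 + 1/(p-1)).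
  refine ⟨C ^ (1 / (p - 1)), C ^ (1 / (p - 1)) + (t₀ ^ (1 + 1 / (p - 1)))⁻¹, by positivity,
    by positivity, fun Λ hkΛ j t ht δ hδ hδ1 => ?_⟩
  have htt₀ : t₀ ≤ t := by
    rw [ht, ht₀]
    gcongr
    have : 0 ≤ 2 * (j : ℝ) * Real.pi := by positivity
    linarith
  have ht0 : 0 < t := ht₀pos.trans_le htt₀
  have hΛ1 : (1 : ℝ) ≤ Λ := by exact_mod_cast hk.trans hkΛ
  have hpow1 : (1 : ℝ) ≤ (Λ : ℝ) ^ ((k : ℝ) / 2) := Real.one_le_rpow hΛ1 (by positivity)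
  set τ : ℝ := (Λ : ℝ) ^ ((k : ℝ) / 2) * t with hτ
  have hτ₀ : t₀ ≤ τ := htt₀.trans (le_mul_of_one_le_left ht0.le hpow1)
  have hτ0 : 0 < τ := ht₀pos.trans_le hτ₀
  have hscale : t₀ ^ (1 + 1 / (p - 1)) ≤ sliceScale Λ k p t δ := by
    rw [sliceScale, ← hτ, le_div_iff₀ (by positivity)]
    have h1 : (δ / 2) ^ (1 / (p - 1)) ≤ 1 :=
      Real.rpow_le_one (by positivity) (by linarith) (by positivity)
    calc t₀ ^ (1 + 1 / (p - 1)) * (δ / 2) ^ (1 / (p - 1)) ≤ t₀ ^ (1 + 1 / (p - 1)) * 1 := by gcongr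
      _ ≤ τ ^ (1 + 1 / (p - 1)) := by rw [mul_one]; gcongr
  have hscale0 : 0 < sliceScale Λ k p t δ := lt_of_lt_of_le (by positivity) hscale
  set r : ℕ := ⌈C ^ (1 / (p - 1)) * sliceScale Λ k p t δ⌉₊ with hr
  have hr1 : C ^ (1 / (p - 1)) * sliceScale Λ k p t δ ≤ r := Nat.le_ceil _
  have hr0 : (0 : ℝ) < r := lt_of_lt_of_le (by positivity) hr1
  refine ⟨r, hr1, ?_, ?_, ?_⟩
  · have h1 : (r : ℝ) < C ^ (1 / (p - 1)) * sliceScale Λ k p t δ + 1 :=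
      Nat.ceil_lt_add_one (by positivity)
    have h2 : 1 ≤ (t₀ ^ (1 + 1 / (p - 1)))⁻¹ * sliceScale Λ k p t δ := by
      rw [inv_mul_eq_div, one_le_div (by positivity)]
      exact hscale
    rw [add_mul]
    linarith
  · refine one_sub_le_successProb hkΛ hδ.le hδ1 (P := idealP Λ k t) ?_
      (by rw [ht]; exact norm_idealP_entry_eq_one hkΛ j)
    have h1 : idealP Λ k t = idealP Λ k (t / r) ^ r := by
      rw [idealP_pow, mul_div_cancel₀ _ hr0.ne']
    rw [Circuit.op_repeated, h1]
    refine (norm_pow_sub_pow_le (Circuit.norm_op _ _).le (norm_idealP _ _ _).le r).trans ?_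
    have h2 := hF Λ hkΛ (t / r)
    rw [abs_of_nonneg (by positivity), ← mul_div_assoc, ← hτ] at h2
    exact (mul_le_mul_of_nonneg_left h2 hr0.le).trans (slice_error_le hC hτ0 hp hδ hr0 hr1)
  · rw [Circuit.sOneCount_repeated, Nat.cast_mul]
    refine mul_le_mul_of_nonneg_left ((Circuit.sOneCount_fockPrep_le hp hN _).trans ?_) hr0.le
    gcongr
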